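/- **Definitions.** An instance of $k$-Median is a finite metric space $(X,d)$ with $n=|X|$ points and rational distances, together with an integer $1\le k\le n$. A $k$-clustering of $X$ is a pair $(C,P)$ of a set $C=\{c_1,\dots,c_k\}\subseteq X$ of $k$ centers and a partition $P=\{X_1,\dots,X_k\}$ of $X$ into $k$ nonempty clusters, and its cost is $\sum_{i=1}^{k}\sum_{x\in X_i} d(c_i,x)$. The task is to output a $k$-clustering of minimum cost. Algorithms are deterministic multi-tape (multi-stack) Turing machines; distances are written as binary fractions. For a parameter $N$ of the instances, an algorithm runs in time $2^{o(N)}$ if, for some function $f$ with $f(N)=o(N)$ and some polynomial $p$, it halts on every instance $x$ within $2^{f(N(x))}\cdot p(|x|)$ steps, where $|x|$ is the length of the encoding of $x$. The *Exponential Time Hypothesis* (ETH) states that for every $q\ge 3$ the satisfiability problem for $q$-CNF formulas (each clause being a disjunction of at most $q$ literals) can be solved neither in time $2^{o(n)}$ nor in time $2^{o(m)}$, where $n$ is the number of variables and $m$ is the number of clauses. **Theorem.** 1. If ETH holds, then there is no algorithm that solves $k$-Median in time $2^{o(n)}$, where $n$ is the number of points of $X$. 2. Let $G=(V,E)$ be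 a connected graph on $n$ vertices and $1\le k\le n$. Then $G$ has a dominating set of size $k$ if and only if the $k$-Median instance $(V,d_G)$, where $d_G$ is the shortest-path metric of $G$ (so that the points are exactly the $n$ vertices of $G$), has a $k$-clustering of cost exactly $n-k$. 3. The same equivalence holds for every graph $G$ on $n$ vertices, connected or not, when $d_G(u,v)=\infty$ for $u,v$ in different components. -/

import Mathlib

open Filter Asymptotics

/-! ### Algorithms and running time

The machines are Mathlib's multi-stack Turing machines `Turing.FinTM2`, and time is the number of
their steps. Inputs and outputs are words over the alphabet `Option Bool`, in which `none` serves as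
a separator. -/

/-- A computational problem: its valid instances, their encoding as words, and the relation saying
which words are correct answers to an instance. -/
structure CompProblem where
  /-- the valid instances -/
  Inst : Type
  /-- the word given to the machine -/
  encode : Inst → List (Option Bool)
  /-- `Correct x w`: the word `w` is a correct answer to the instance `x` -/
  Correct : Inst → List (Option Bool) → Prop

/-- Some Turing machine halts on every instance `x` after at most `T x` steps, with a correct
answer on its output stack. -/
def CompProblem.SolvableWithin (Q : CompProblem) (T : Q.Inst → ℝ) : Prop :=
  ∃ M : Turing.TM2ComputableAux (Option Bool) (Option Bool), ∀ x : Q.Inst,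
    ∃ (w : List (Option Bool)) (t : ℕ), Q.Correct x w ∧ (t : ℝ) ≤ T x ∧
      Nonempty (Turing.TM2OutputsInTime M.tm
        ((Q.encode x).map M.inputAlphabet.symm) (some (w.map M.outputAlphabet.symm)) t)

/-- The problem can be solved in time `2 ^ o(N)`, where `N = size x`, up to a factor polynomial in
the length of the encoded instance. -/
def CompProblem.SolvableInSubexpTime (Q : CompProblem) (size : Q.Inst → ℕ) : Prop :=
  ∃ (f : ℕ → ℝ) (p : Polynomial ℕ), f =o[atTop] (fun N : ℕ => (N : ℝ)) ∧
    Q.SolvableWithin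
      (fun x => (2 : ℝ) ^ f (size x) * ((p.eval (Q.encode x).length : ℕ) : ℝ))

/-- The unary code of `a`, followed by a separator. -/
def encUnary (a : ℕ) : List (Option Bool) :=
  List.replicate a (some true) ++ [none]

/-- The binary code of `a`, followed by a separator. -/
def encBinary (a : ℕ) : List (Option Bool) :=
  (Computability.encodeNat a).map some ++ [none]

/-! ### Satisfiability and the Exponential Time Hypothesis -/

/-- A `q`-CNF formula: a conjunction of clauses over the variables `0, …, numVars - 1`, each clause
a disjunction of at most `q` literals. The literal `(i, true)` is the variable `i`, and `(i, false)`
is its negation. -/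
structure QCNF (q : ℕ) where
  numVars : ℕ
  clauses : List (List (Fin numVars × Bool))
  length_le : ∀ c ∈ clauses, c.length ≤ q

namespace QCNF

variable {q : ℕ}

/-- The number of clauses. -/
def numClauses (φ : QCNF q) : ℕ := φ.clauses.length

/-- Some truth assignment makes a literal of every clause true. -/
def Satisfiable (φ : QCNF q) : Prop :=
  ∃ a : Fin φ.numVars → Bool, ∀ c ∈ φ.clauses, ∃ l ∈ c, a l.1 = l.2

/-- A literal is written as its sign followed by the index of its variable, a clause as the sequence
of its literals followed by a separator, and a formula as the number of its variables followed by
its clauses. -/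
def encode (φ : QCNF q) : List (Option Bool) :=
  encUnary φ.numVars ++
    φ.clauses.flatMap (fun c => c.flatMap (fun l => some l.2 :: encUnary l.1) ++ [none])

end QCNF

/-- The problem `q`-SAT: the answer is the one-letter word telling whether the formula is
satisfiable. -/
def qSAT (q : ℕ) : CompProblem where
  Inst := QCNF q
  encode := QCNF.encode
  Correct φ w := ∃ b : Bool, (b = true ↔ φ.Satisfiable) ∧ w = [some b]

/-- The Exponential Time Hypothesis: for `q ≥ 3`, `q`-SAT can be solved neither in time `2 ^ o(n)`
nor in time `2 ^ o(m)`, for `n` the number of variables and `m` the number of clauses. -/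
def ExponentialTimeHypothesis : Prop :=
  ∀ q : ℕ, 3 ≤ q →
    ¬ (qSAT q).SolvableInSubexpTime QCNF.numVars ∧
    ¬ (qSAT q).SolvableInSubexpTime QCNF.numClauses

/-! ### Clusterings and `k`-Median -/

/-- A pair `(C, P)` of a set `C = {c₁, …, cₖ}` of `k` centers in `X` and a partition `P` of `X` into
`k` clusters, the `i`-th of which consists of the points `x` with `cluster x = i`. -/
structure Clustering (X : Type*) (k : ℕ) where
  center : Fin k → X
  center_injective : Function.Injective center
  cluster : X → Fin k
  cluster_surjective : Function.Surjective cluster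

/-- The `k`-median cost: the sum over all clusters of the distances of their points from the
center. -/
def Clustering.cost {X R : Type*} [Fintype X] [AddCommMonoid R] {k : ℕ} (S : Clustering X k)
    (d : X → X → R) : R :=
  ∑ i : Fin k, ∑ x : X with S.cluster x = i, d (S.center i) x

/-- An instance of `k`-Median: a finite metric space on the points `0, …, n - 1`, with rational
distances, and a number `k` of centers. -/
structure KMedianInstance where
  n : ℕ
  d : Fin n → Fin n → ℚ
  d_self : ∀ x, d x x = 0
  d_pos : ∀ x y, x ≠ y → 0 < d x y
  d_symm : ∀ x y, d x y = d y x
  d_triangle : ∀ x y z, d x z ≤ d x y + d y z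
  k : ℕ
  one_le_k : 1 ≤ k
  k_le_n : k ≤ n

namespace KMedianInstance

/-- The numbers `n` and `k`, followed by the rows of the distance matrix, each distance being
written as its numerator and its denominator in binary. -/
def encode (I : KMedianInstance) : List (Option Bool) :=
  encUnary I.n ++ encUnary I.k ++
    (List.finRange I.n).flatMap (fun x => (List.finRange I.n).flatMap (fun y =>
      encBinary (I.d x y).num.natAbs ++ encBinary (I.d x y).den))

/-- `S` is a `k`-clustering of minimum cost. -/
def IsOptimal (I : KMedianInstance) (S : Clustering (Fin I.n) I.k) : Prop :=
  ∀ S' : Clustering (Fin I.n) I.k, S.cost I.d ≤ S'.cost I.d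

end KMedianInstance

/-- A clustering is written as the list of its centers, followed by the list of the indices of the
clusters to which the points belong. -/
def Clustering.encode {n k : ℕ} (S : Clustering (Fin n) k) : List (Option Bool) :=
  (List.finRange k).flatMap (fun i => encUnary (S.center i)) ++
    (List.finRange n).flatMap (fun x => encUnary (S.cluster x))

/-- The problem `k`-Median: find a clustering `(C, P)` of minimum cost. -/
def kMedian : CompProblem where
  Inst := KMedianInstance
  encode := KMedianInstance.encode
  Correct I w := ∃ S : Clustering (Fin I.n) I.k, I.IsOptimal S ∧ w = S.encode

/-! ### Dominating sets and the shortest-path metric -/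

/-- `S` is a dominating set: every vertex is in `S` or has a neighbor in `S`. -/
def SimpleGraph.IsDominatingSet {V : Type*} (G : SimpleGraph V) (S : Finset V) : Prop :=
  ∀ v, v ∈ S ∨ ∃ u ∈ S, G.Adj u v

/-- The `k`-Median instance whose points are the vertices of a connected graph, with the
shortest-path metric. -/
noncomputable def shortestPathInstance {n : ℕ} (G : SimpleGraph (Fin n)) (hG : G.Connected) (k : ℕ)
    (hk : 1 ≤ k) (hkn : k ≤ n) : KMedianInstance where
  n := n
  d u v := (G.dist u v : ℚ)
  d_self u := by simp
  d_pos u v h := by exact_mod_cast hG.pos_dist_of_ne h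
  d_symm u v := by rw [SimpleGraph.dist_comm]
  d_triangle u v w := by exact_mod_cast hG.dist_triangle
  k := k
  one_le_k := hk
  k_le_n := hkn

/-! ### Structured programs for multi-stack machines -/

/-! Hardness comes from a reduction of `q`-SAT whose number of points is linear in the number m of
clauses. Distinct points have distance 4, 5 or 6, so the triangle inequality is automatic (6 ≤ 4 +
4). The points are three special ones z, w, w'; for every literal occurrence, a copy of both
literals of its variable v and of a point `tt v`; and one point for every clause. Distance 4 joins
any two literals, a literal to `tt` of its variable and to the clauses containing it, z to the
clauses and to w, and w to w'. The distance from z to w' is 5; all other distances are 6. The number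
k of centers is one more than the number of variables that occur.

A satisfying assignment gives the centers w and the true literals, with all other points at distance
4. Without one, z and an arbitrary choice of literals cost at most 1 more, because of w'. At most k
points have distance 0 from their center, so in an optimal clustering every point is within 4,
respectively 5, of its center (`Clustering.dist_center_le`). Each variable then needs a center of
its own at `tt v` or at a literal of v, and one center is left for w'. In the satisfiable case this
is w or w', so z is no center. In the unsatisfiable case it must be z: otherwise the clauses would
be served by literals alone, which yields a satisfying assignment (`satisfiable_of_clustering`). So
z, which is the point 0, is a center of an optimal clustering exactly if the formula is
unsatisfiable (`optimal_iff`), and the answer is read off the list of centers without computing any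
cost.

There are at most (3q+1)m+3 points, so time 2^o(n) for k-Median gives time 2^o(m) for `q`-SAT; the
clause form of ETH at q = 3 is contradicted. Most of the length is the reduction as an actual
machine: programs are built from straight-line code, composition, branching and loops, each with a
step bound (`Runs`), and run next to the given k-Median machine on disjoint stacks (`runs_decider`).

The dominating set equivalences use the same count with unit 1: at most k points cost 0 and all
others at least 1, so cost n - k forces every point to equal its center or be adjacent to it. -/

namespace StackProgram

open Turing

variable {K : Type} {Γ : K → Type} {σ : Type}

/-- Relabel a statement along `f`, and continue with `k` where it halts. -/
def subst {Λ₁ Λ₂ : Type} (f : Λ₁ → Λ₂) (k : TM2.Stmt Γ Λ₂ σ) :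
    TM2.Stmt Γ Λ₁ σ → TM2.Stmt Γ Λ₂ σ
  | .push i g q => .push i g (subst f k q)
  | .peek i g q => .peek i g (subst f k q)
  | .pop i g q => .pop i g (subst f k q)
  | .load g q => .load g (subst f k q)
  | .branch b q₁ q₂ => .branch b (subst f k q₁) (subst f k q₂)
  | .goto l => .goto fun v => f (l v)
  | .halt => k

/-- A program is a machine whose halting means that control passes to what follows it. -/
structure Prog (Γ : K → Type) (σ : Type) where
  /-- the labels -/
  Λ : Type
  /-- there are finitely many labels -/
  fin : Fintype Λ
  /-- the entry -/
  main : Λ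
  /-- the code -/
  m : Λ → TM2.Stmt Γ Λ σ

/-- The contents of the registers and of the stacks. -/
abbrev State (Γ : K → Type) (σ : Type) : Type := σ × (∀ k, List (Γ k))

/-- Straight-line code as a program. -/
def atom (q : TM2.Stmt Γ Empty σ) : Prog Γ σ where
  Λ := Unit
  fin := inferInstance
  main := ()
  m _ := subst Empty.elim .halt q

/-- Run `P`, then `Q`. -/
def seq (P Q : Prog Γ σ) : Prog Γ σ where
  Λ := P.Λ ⊕ Q.Λ
  fin := haveI := P.fin; haveI := Q.fin; inferInstance
  main := .inl P.main
  m := Sum.elim (fun l => subst Sum.inl (.goto fun _ => .inr Q.main) (P.m l))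
    (fun l => subst Sum.inr .halt (Q.m l))

/-- Run `P` if the registers satisfy `b`, and `Q` otherwise. -/
def ite (b : σ → Bool) (P Q : Prog Γ σ) : Prog Γ σ where
  Λ := Option (P.Λ ⊕ Q.Λ)
  fin := haveI := P.fin; haveI := Q.fin; inferInstance
  main := none
  m := fun o => o.elim
    (.branch b (.goto fun _ => some (.inl P.main)) (.goto fun _ => some (.inr Q.main)))
    (Sum.elim (fun l => subst (some ∘ Sum.inl) .halt (P.m l))
      (fun l => subst (some ∘ Sum.inr) .halt (Q.m l)))

/-- Execute `q`; as long as the registers then satisfy `b`, run `P` and start again. -/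
def loop (q : TM2.Stmt Γ Empty σ) (b : σ → Bool) (P : Prog Γ σ) : Prog Γ σ where
  Λ := Option P.Λ
  fin := haveI := P.fin; inferInstance
  main := none
  m := fun o => o.elim
    (subst Empty.elim (.branch b (.goto fun _ => some P.main) .halt) q)
    (fun l => subst some (.goto fun _ => none) (P.m l))

variable [DecidableEq K]

/-- The configuration `c'` is reached from `c` in exactly `n` steps. -/
def ReachesIn {Λ : Type} (M : Λ → TM2.Stmt Γ Λ σ) :
    ℕ → TM2.Cfg Γ Λ σ → TM2.Cfg Γ Λ σ → Prop
  | 0, c, c' => c = c'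
  | n + 1, c, c' => ∃ d, TM2.step M c = some d ∧ ReachesIn M n d c'

theorem ReachesIn.trans {Λ : Type} {M : Λ → TM2.Stmt Γ Λ σ} {a b : ℕ} {c d e : TM2.Cfg Γ Λ σ}
    (h : ReachesIn M a c d) (h' : ReachesIn M b d e) : ReachesIn M (a + b) c e := by
  induction a generalizing c with
  | zero => obtain rfl : c = d := h; simpa using h'
  | succ a ih =>
    obtain ⟨x, hx, hr⟩ := h
    rw [Nat.succ_add]
    exact ⟨x, hx, ih hr⟩

theorem reachesIn_iff_iterate {Λ : Type} {M : Λ → TM2.Stmt Γ Λ σ} {n : ℕ}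
    {c c' : TM2.Cfg Γ Λ σ} :
    ReachesIn M n c c' ↔ (flip Bind.bind (TM2.step M))^[n] (some c) = some c' := by
  induction n generalizing c with
  | zero => simp [ReachesIn]
  | succ n ih =>
    rw [Function.iterate_succ_apply]
    have hnone : ∀ n : ℕ, (flip Bind.bind (TM2.step M))^[n] none = none := by
      intro n
      induction n with
      | zero => rfl
      | succ n ih => rw [Function.iterate_succ_apply]; exact ih
    have : flip Bind.bind (TM2.step M) (some c) = TM2.step M c := rfl
    rw [this, ReachesIn]
    cases h : TM2.step M c with
    | none => rw [hnone]; simp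
    | some d => simp [ih]

/-- A step-by-step simulation preserves the exact number of steps. Relabelling of programs and
embedding into more stacks are both instances. -/
theorem ReachesIn.map {K' : Type} [DecidableEq K'] {Γ' : K' → Type} {σ' Λ Λ' : Type}
    {M : Λ → TM2.Stmt Γ Λ σ} {M' : Λ' → TM2.Stmt Γ' Λ' σ'}
    (F : TM2.Cfg Γ Λ σ → TM2.Cfg Γ' Λ' σ')
    (hF : ∀ c d, TM2.step M c = some d → TM2.step M' (F c) = some (F d)) {n : ℕ}
    {c d : TM2.Cfg Γ Λ σ} (h : ReachesIn M n c d) : ReachesIn M' n (F c) (F d) := by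
  induction n generalizing c with
  | zero => exact congrArg F h
  | succ n ih =>
    obtain ⟨x, hx, hr⟩ := h
    exact ⟨F x, hF _ _ hx, ih hr⟩

/-- What straight-line code does. -/
def exec (q : TM2.Stmt Γ Empty σ) (s : State Γ σ) : State Γ σ :=
  ((TM2.stepAux q s.1 s.2).var, (TM2.stepAux q s.1 s.2).stk)

/-- The continuation `k` is executed within the same machine step in which the original statement
would have halted, so gluing code costs no time. -/
theorem stepAux_subst {Λ₁ Λ₂ : Type} (f : Λ₁ → Λ₂) (k : TM2.Stmt Γ Λ₂ σ) (q : TM2.Stmt Γ Λ₁ σ)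
    (v : σ) (S : ∀ k, List (Γ k)) :
    TM2.stepAux (subst f k q) v S =
      (TM2.stepAux q v S).l.elim
        (TM2.stepAux k (TM2.stepAux q v S).var (TM2.stepAux q v S).stk)
        (fun l => ⟨some (f l), (TM2.stepAux q v S).var, (TM2.stepAux q v S).stk⟩) := by
  induction q generalizing v S with
  | push i g q ih => exact ih _ _
  | peek i g q ih => exact ih _ _
  | pop i g q ih => exact ih _ _
  | load g q ih => exact ih _ _
  | branch b q₁ q₂ ih₁ ih₂ =>
    simp only [subst, TM2.stepAux]
    cases b v
    · exact ih₂ _ _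
    · exact ih₁ _ _
  | goto l => rfl
  | halt => rfl

/-- With no labels available, straight-line code cannot jump and always falls through to `k`. -/
theorem stepAux_subst_empty {Λ₂ : Type} (k : TM2.Stmt Γ Λ₂ σ) (q : TM2.Stmt Γ Empty σ)
    (s : State Γ σ) :
    TM2.stepAux (subst Empty.elim k q) s.1 s.2 = TM2.stepAux k (exec q s).1 (exec q s).2 := by
  rw [stepAux_subst]
  cases h : (TM2.stepAux q s.1 s.2).l with
  | none => rfl
  | some l => exact l.elim

/-- The program `P`, started in the state `s`, halts in the state `s'` after at most `t` steps. -/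
def Runs (P : Prog Γ σ) (s s' : State Γ σ) (t : ℕ) : Prop :=
  ∃ n ≤ t, ReachesIn P.m n ⟨some P.main, s.1, s.2⟩ ⟨none, s'.1, s'.2⟩

theorem Runs.mono {P : Prog Γ σ} {s s' : State Γ σ} {t t' : ℕ} (h : Runs P s s' t)
    (htt' : t ≤ t') : Runs P s s' t' := by
  obtain ⟨n, hn, h⟩ := h
  exact ⟨n, hn.trans htt', h⟩

theorem Runs.cast {P : Prog Γ σ} {s s' s'' : State Γ σ} {t t' : ℕ} (h : Runs P s s' t)
    (hs : s' = s'') (htt' : t ≤ t') : Runs P s s'' t' := hs ▸ h.mono htt'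

theorem runs_atom (q : TM2.Stmt Γ Empty σ) (s : State Γ σ) : Runs (atom q) s (exec q s) 1 := by
  refine ⟨1, le_rfl, _, rfl, ?_⟩
  change TM2.stepAux (subst Empty.elim .halt q) s.1 s.2 = _
  rw [stepAux_subst_empty]
  rfl

theorem runs_atom' {q : TM2.Stmt Γ Empty σ} {s s' : State Γ σ} (h : exec q s = s') :
    Runs (atom q) s s' 1 := h ▸ runs_atom q s

/-- Relabel a configuration; a halting one passes to the label `e`. -/
def relabel {Λ₁ Λ₂ : Type} (f : Λ₁ → Λ₂) (e : Option Λ₂) (c : TM2.Cfg Γ Λ₁ σ) :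
    TM2.Cfg Γ Λ₂ σ :=
  ⟨c.l.elim e (fun l => some (f l)), c.var, c.stk⟩

/-- The halted configuration is sent to the entry `e` of the code that follows, so the image of a
complete run ends exactly where the next program starts. -/
theorem ReachesIn.relabel_goto {Λ₁ Λ₂ : Type} {M : Λ₁ → TM2.Stmt Γ Λ₁ σ}
    {M' : Λ₂ → TM2.Stmt Γ Λ₂ σ} (f : Λ₁ → Λ₂) (e : Λ₂)
    (h : ∀ l, M' (f l) = subst f (.goto fun _ => e) (M l)) {n : ℕ} {c d : TM2.Cfg Γ Λ₁ σ}
    (hr : ReachesIn M n c d) : ReachesIn M' n (relabel f (some e) c) (relabel f (some e) d) := by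
  refine hr.map _ ?_
  rintro ⟨_ | l, v, S⟩ d hd
  · simp at hd
  · simp only [TM2.step, Option.some.injEq] at hd
    subst hd
    simp only [relabel, Option.elim, TM2.step, h, stepAux_subst]
    cases (TM2.stepAux (M l) v S).l <;> rfl

theorem ReachesIn.relabel_halt {Λ₁ Λ₂ : Type} {M : Λ₁ → TM2.Stmt Γ Λ₁ σ}
    {M' : Λ₂ → TM2.Stmt Γ Λ₂ σ} (f : Λ₁ → Λ₂)
    (h : ∀ l, M' (f l) = subst f .halt (M l)) {n : ℕ} {c d : TM2.Cfg Γ Λ₁ σ}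
    (hr : ReachesIn M n c d) : ReachesIn M' n (relabel f none c) (relabel f none d) := by
  refine hr.map _ ?_
  rintro ⟨_ | l, v, S⟩ d hd
  · simp at hd
  · simp only [TM2.step, Option.some.injEq] at hd
    subst hd
    simp only [relabel, Option.elim, TM2.step, h, stepAux_subst]
    cases (TM2.stepAux (M l) v S).l <;> rfl

theorem Runs.seq {P Q : Prog Γ σ} {s s' s'' : State Γ σ} {t t' : ℕ} (h : Runs P s s' t)
    (h' : Runs Q s' s'' t') : Runs (seq P Q) s s'' (t + t') := by
  obtain ⟨a, ha, hP⟩ := h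
  obtain ⟨b, hb, hQ⟩ := h'
  exact ⟨a + b, by omega,
    (hP.relabel_goto (M' := (StackProgram.seq P Q).m) Sum.inl (.inr Q.main) (fun _ => rfl)).trans
      (hQ.relabel_halt (M' := (StackProgram.seq P Q).m) Sum.inr (fun _ => rfl))⟩

theorem Runs.seq' {P Q : Prog Γ σ} {s s' r r' : State Γ σ} {t t' : ℕ} (h : Runs P s s' t)
    (e : s' = r) (h' : Runs Q r r' t') : Runs (StackProgram.seq P Q) s r' (t + t') :=
  h.seq (e ▸ h')

theorem Runs.ite_true {b : σ → Bool} {P Q : Prog Γ σ} {s s' : State Γ σ} {t : ℕ}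
    (hb : b s.1 = true) (h : Runs P s s' t) : Runs (ite b P Q) s s' (t + 1) := by
  obtain ⟨a, ha, hP⟩ := h
  refine ⟨a + 1, by omega, _, rfl,
    ?_⟩
  have := hP.relabel_halt (M' := (ite b P Q).m) (some ∘ Sum.inl) (fun _ => rfl)
  simpa [ite, TM2.stepAux, hb, relabel] using this

theorem Runs.ite_false {b : σ → Bool} {P Q : Prog Γ σ} {s s' : State Γ σ} {t : ℕ}
    (hb : b s.1 = false) (h : Runs Q s s' t) : Runs (ite b P Q) s s' (t + 1) := by
  obtain ⟨a, ha, hP⟩ := h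
  refine ⟨a + 1, by omega, _, rfl,
    ?_⟩
  have := hP.relabel_halt (M' := (ite b P Q).m) (some ∘ Sum.inr) (fun _ => rfl)
  simpa [ite, TM2.stepAux, hb, relabel] using this

theorem Runs.loop_exit {q : TM2.Stmt Γ Empty σ} {b : σ → Bool} {P : Prog Γ σ} {s s' : State Γ σ}
    (hq : exec q s = s') (hb : b s'.1 = false) : Runs (loop q b P) s s' 1 := by
  subst hq
  refine ⟨1, le_rfl, _, rfl, ?_⟩
  change TM2.stepAux (subst Empty.elim (.branch b (.goto fun _ => some P.main) .halt) q) s.1 s.2 = _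
  rw [stepAux_subst_empty]
  simp [TM2.stepAux, hb]
  rfl

/-- Executing `q` and testing `b` is one machine step, and the body jumps back without an extra one;
hence the single `+ 1` per round. -/
theorem Runs.loop_step {q : TM2.Stmt Γ Empty σ} {b : σ → Bool} {P : Prog Γ σ}
    {s s' s'' s''' : State Γ σ} {t t' : ℕ} (hq : exec q s = s') (hb : b s'.1 = true)
    (h : Runs P s' s'' t) (h' : Runs (loop q b P) s'' s''' t') :
    Runs (loop q b P) s s''' (t + 1 + t') := by
  subst hq
  obtain ⟨a, ha, hP⟩ := h
  obtain ⟨c, hc, hL⟩ := h'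
  have h1 : ReachesIn (loop q b P).m 1 ⟨some (loop q b P).main, s.1, s.2⟩
      (relabel some (some none) ⟨some P.main, (exec q s).1, (exec q s).2⟩) := by
    refine ⟨_, rfl, ?_⟩
    change TM2.stepAux
      (subst Empty.elim (.branch b (.goto fun _ => some P.main) .halt) q) s.1 s.2 = _
    rw [stepAux_subst_empty]
    simp [TM2.stepAux, hb, relabel]
    rfl
  have h2 := hP.relabel_goto (M' := (loop q b P).m) some none (fun _ => rfl)
  exact ⟨1 + a + c, by omega, (h1.trans h2).trans hL⟩

/-! ### Machines working on some of the stacks -/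

variable {K' : Type} [DecidableEq K'] {Γ' : K' → Type} {σ' : Type}

/-- The alphabets of two families of stacks side by side. -/
abbrev Side (Γ : K → Type) (Γ' : K' → Type) : K ⊕ K' → Type
  | .inl k => Γ k
  | .inr k => Γ' k

/-- A statement for the left family of stacks. -/
def liftLeft {Λ : Type} :
    TM2.Stmt Γ Λ σ → TM2.Stmt (Side Γ Γ') Λ (σ × σ')
  | .push i g q => .push (.inl i) (fun v => g v.1) (liftLeft q)
  | .peek i g q => .peek (.inl i) (fun v o => (g v.1 o, v.2)) (liftLeft q)
  | .pop i g q => .pop (.inl i) (fun v o => (g v.1 o, v.2)) (liftLeft q)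
  | .load g q => .load (fun v => (g v.1, v.2)) (liftLeft q)
  | .branch b q₁ q₂ => .branch (fun v => b v.1) (liftLeft q₁) (liftLeft q₂)
  | .goto l => .goto fun v => l v.1
  | .halt => .halt

/-- A statement for the right family of stacks. -/
def liftRight {Λ : Type} :
    TM2.Stmt Γ' Λ σ' → TM2.Stmt (Side Γ Γ') Λ (σ × σ')
  | .push i g q => .push (.inr i) (fun v => g v.2) (liftRight q)
  | .peek i g q => .peek (.inr i) (fun v o => (v.1, g v.2 o)) (liftRight q)
  | .pop i g q => .pop (.inr i) (fun v o => (v.1, g v.2 o)) (liftRight q)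
  | .load g q => .load (fun v => (v.1, g v.2)) (liftRight q)
  | .branch b q₁ q₂ => .branch (fun v => b v.2) (liftRight q₁) (liftRight q₂)
  | .goto l => .goto fun v => l v.2
  | .halt => .halt

/-- Two families of stacks side by side. -/
def join (S : ∀ k, List (Γ k)) (S' : ∀ k, List (Γ' k)) :
    ∀ k, List (Side Γ Γ' k)
  | .inl k => S k
  | .inr k => S' k

theorem update_join_inl (S : ∀ k, List (Γ k)) (S' : ∀ k, List (Γ' k)) (k : K) (x : List (Γ k)) :
    Function.update (join S S') (.inl k) x = join (Function.update S k x) S' := by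
  funext j
  rcases j with j | j
  · by_cases h : j = k
    · subst h
      exact (Function.update_self ..).trans (Function.update_self j x S).symm
    · exact (Function.update_of_ne (by simpa using h) ..).trans
        (Eq.symm (by exact Function.update_of_ne h x S))
  · exact Function.update_of_ne (by simp) ..

theorem update_join_inr (S : ∀ k, List (Γ k)) (S' : ∀ k, List (Γ' k)) (k : K')
    (x : List (Γ' k)) :
    Function.update (join S S') (.inr k) x = join S (Function.update S' k x) := by
  funext j
  rcases j with j | j
  · exact Function.update_of_ne (by simp) ..
  · by_cases h : j = k
    · subst h
      exact (Function.update_self ..).trans (Function.update_self j x S').symm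
    · exact (Function.update_of_ne (by simpa using h) ..).trans
        (Eq.symm (by exact Function.update_of_ne h x S'))

/-- A lifted statement touches only its own stacks and its own register component; the other half is
carried along unchanged. -/
theorem stepAux_liftLeft {Λ : Type} (q : TM2.Stmt Γ Λ σ) (v : σ) (v' : σ')
    (S : ∀ k, List (Γ k)) (S' : ∀ k, List (Γ' k)) :
    TM2.stepAux (liftLeft q) (v, v') (join S S') =
      ⟨(TM2.stepAux q v S).l, ((TM2.stepAux q v S).var, v'),
        join (TM2.stepAux q v S).stk S'⟩ := by
  induction q generalizing v S with
  | push i g q ih =>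
    exact (congrArg (TM2.stepAux (liftLeft q) _) (update_join_inl ..)).trans (ih _ _)
  | peek i g q ih => exact ih _ _
  | pop i g q ih => exact (congrArg (TM2.stepAux (liftLeft q) _) (update_join_inl ..)).trans (ih _ _)
  | load g q ih => exact ih _ _
  | branch b q₁ q₂ ih₁ ih₂ =>
    simp only [liftLeft, TM2.stepAux]
    cases b v
    · exact ih₂ _ _
    · exact ih₁ _ _
  | goto l => rfl
  | halt => rfl

theorem stepAux_liftRight {Λ : Type} (q : TM2.Stmt Γ' Λ σ') (v : σ) (v' : σ')
    (S : ∀ k, List (Γ k)) (S' : ∀ k, List (Γ' k)) :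
    TM2.stepAux (liftRight q) (v, v') (join S S') =
      ⟨(TM2.stepAux q v' S').l, (v, (TM2.stepAux q v' S').var),
        join S (TM2.stepAux q v' S').stk⟩ := by
  induction q generalizing v' S' with
  | push i g q ih =>
    exact (congrArg (TM2.stepAux (liftRight q) _) (update_join_inr ..)).trans (ih _ _)
  | peek i g q ih => exact ih _ _
  | pop i g q ih => exact (congrArg (TM2.stepAux (liftRight q) _) (update_join_inr ..)).trans (ih _ _)
  | load g q ih => exact ih _ _
  | branch b q₁ q₂ ih₁ ih₂ =>
    simp only [liftRight, TM2.stepAux]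
    cases b v'
    · exact ih₂ _ _
    · exact ih₁ _ _
  | goto l => rfl
  | halt => rfl

/-- A program for the left family of stacks. -/
def Prog.left (P : Prog Γ σ) : Prog (Side Γ Γ') (σ × σ') where
  Λ := P.Λ
  fin := P.fin
  main := P.main
  m l := liftLeft (P.m l)

/-- A program for the right family of stacks. -/
def Prog.right (P : Prog Γ' σ') : Prog (Side Γ Γ') (σ × σ') where
  Λ := P.Λ
  fin := P.fin
  main := P.main
  m l := liftRight (P.m l)

theorem Runs.left {P : Prog Γ σ} {s s' : State Γ σ} {t : ℕ} (h : Runs P s s' t) (v : σ')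
    (S : ∀ k, List (Γ' k)) : Runs P.left ((s.1, v), join s.2 S) ((s'.1, v), join s'.2 S) t := by
  obtain ⟨n, hn, h⟩ := h
  refine ⟨n, hn, h.map (M' := (Prog.left P).m)
    (fun c => (⟨c.l, (c.var, v), join c.stk S⟩ : TM2.Cfg _ _ _)) ?_⟩
  rintro ⟨_ | l, u, T⟩ d hd
  · cases hd
  · obtain rfl := Option.some.inj hd
    exact congrArg some (stepAux_liftLeft ..)

theorem Runs.right {P : Prog Γ' σ'} {s s' : State Γ' σ'} {t : ℕ} (h : Runs P s s' t) (v : σ)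
    (S : ∀ k, List (Γ k)) : Runs P.right ((v, s.1), join S s.2) ((v, s'.1), join S s'.2) t := by
  obtain ⟨n, hn, h⟩ := h
  refine ⟨n, hn, h.map (M' := (Prog.right P).m)
    (fun c => (⟨c.l, (v, c.var), join S c.stk⟩ : TM2.Cfg _ _ _)) ?_⟩
  rintro ⟨_ | l, u, T⟩ d hd
  · cases hd
  · obtain rfl := Option.some.inj hd
    exact congrArg some (stepAux_liftRight ..)

end StackProgram

/-! ### The reduction from satisfiability: data -/

namespace SatToMedian

open Turing StackProgram

/-- The kinds of points. -/
inductive Kind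
  | z | w | w' | lit | tt | cl
  deriving DecidableEq

instance : Fintype Kind :=
  ⟨{.z, .w, .w', .lit, .tt, .cl}, fun x => by cases x <;> decide⟩

/-- What the machine stores for a variable: whether it occurs positively or negatively in the
current clause, whether it is the one just read, and whether it has occurred at all. -/
structure Cell where
  pos : Bool
  neg : Bool
  cur : Bool
  used : Bool
  deriving DecidableEq, Fintype, Inhabited

/-- A point is stored as a row of pairs of bits, closed by its kind and a mark. -/
abbrev RSym : Type := (Kind × Bool) ⊕ (Bool × Bool)

/-- The stacks of the reduction. -/
inductive Stk
  | inp | V | V' | A | B | B' | X | N | K₁ | K₂ | O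
  deriving DecidableEq

instance : Fintype Stk :=
  ⟨{.inp, .V, .V', .A, .B, .B', .X, .N, .K₁, .K₂, .O}, fun x => by cases x <;> decide⟩

/-- The alphabets of the stacks. -/
abbrev Alph : Stk → Type
  | .inp => Option Bool
  | .V => Cell
  | .V' => Cell
  | .A => RSym
  | .B => RSym
  | .B' => RSym
  | .X => RSym
  | .N => Unit
  | .K₁ => Unit
  | .K₂ => Unit
  | .O => Option Bool

/-- The registers. -/
structure Reg where
  i : Option (Option Bool) := none
  c : Option Cell := none
  x : Option RSym := none
  y : Option RSym := none
  u : Option Unit := none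
  sgn : Bool := false
  seen : Bool := false
  inter : Bool := false
  flag : Bool := false

noncomputable instance : Fintype Reg :=
  Fintype.ofInjective
    (fun r => (r.i, r.c, r.x, r.y, r.u, r.sgn, r.seen, r.inter, r.flag))
    (fun r r' h => by cases r; cases r'; simpa using h)

/-- The contents of the stacks. -/
structure Mem where
  inp : List (Option Bool) := []
  V : List Cell := []
  V' : List Cell := []
  A : List RSym := []
  B : List RSym := []
  B' : List RSym := []
  X : List RSym := []
  N : List Unit := []
  K₁ : List Unit := []
  K₂ : List Unit := []
  O : List (Option Bool) := []

/-- The contents of the stacks as a function. -/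
def Mem.stk (m : Mem) : ∀ k, List (Alph k)
  | .inp => m.inp
  | .V => m.V
  | .V' => m.V'
  | .A => m.A
  | .B => m.B
  | .B' => m.B'
  | .X => m.X
  | .N => m.N
  | .K₁ => m.K₁
  | .K₂ => m.K₂
  | .O => m.O

/-! ### Access to single stacks. -/

section
variable (m : Mem)

@[simp] theorem Mem.stk_inp : m.stk .inp = m.inp := rfl
@[simp] theorem Mem.stk_V : m.stk .V = m.V := rfl
@[simp] theorem Mem.stk_V' : m.stk .V' = m.V' := rfl
@[simp] theorem Mem.stk_A : m.stk .A = m.A := rfl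
@[simp] theorem Mem.stk_B : m.stk .B = m.B := rfl
@[simp] theorem Mem.stk_B' : m.stk .B' = m.B' := rfl
@[simp] theorem Mem.stk_X : m.stk .X = m.X := rfl
@[simp] theorem Mem.stk_N : m.stk .N = m.N := rfl
@[simp] theorem Mem.stk_K₁ : m.stk .K₁ = m.K₁ := rfl
@[simp] theorem Mem.stk_K₂ : m.stk .K₂ = m.K₂ := rfl
@[simp] theorem Mem.stk_O : m.stk .O = m.O := rfl

@[simp] theorem Mem.update_inp (l : List (Option Bool)) :
    Function.update m.stk .inp l = { m with inp := l }.stk := by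
  funext k; cases k <;> rfl
@[simp] theorem Mem.update_V (l : List Cell) :
    Function.update m.stk .V l = { m with V := l }.stk := by
  funext k; cases k <;> rfl
@[simp] theorem Mem.update_V' (l : List Cell) :
    Function.update m.stk .V' l = { m with V' := l }.stk := by
  funext k; cases k <;> rfl
@[simp] theorem Mem.update_A (l : List RSym) :
    Function.update m.stk .A l = { m with A := l }.stk := by
  funext k; cases k <;> rfl
@[simp] theorem Mem.update_B (l : List RSym) :
    Function.update m.stk .B l = { m with B := l }.stk := by
  funext k; cases k <;> rfl
@[simp] theorem Mem.update_B' (l : List RSym) :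
    Function.update m.stk .B' l = { m with B' := l }.stk := by
  funext k; cases k <;> rfl
@[simp] theorem Mem.update_X (l : List RSym) :
    Function.update m.stk .X l = { m with X := l }.stk := by
  funext k; cases k <;> rfl
@[simp] theorem Mem.update_N (l : List Unit) :
    Function.update m.stk .N l = { m with N := l }.stk := by
  funext k; cases k <;> rfl
@[simp] theorem Mem.update_K₁ (l : List Unit) :
    Function.update m.stk .K₁ l = { m with K₁ := l }.stk := by
  funext k; cases k <;> rfl
@[simp] theorem Mem.update_K₂ (l : List Unit) :
    Function.update m.stk .K₂ l = { m with K₂ := l }.stk := by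
  funext k; cases k <;> rfl
@[simp] theorem Mem.update_O (l : List (Option Bool)) :
    Function.update m.stk .O l = { m with O := l }.stk := by
  funext k; cases k <;> rfl

end

/-- A point: its kind and its row. -/
abbrev Pt : Type := Kind × List (Bool × Bool)

/-- The stored form of a point. -/
def Pt.rec (vis : Bool) (p : Pt) : List RSym := p.2.map .inr ++ [.inl (p.1, vis)]

/-! ### Writing points -/

/-- Move `V'` back to `V`. -/
def restore (g : Cell → Cell) : Prog Alph Reg :=
  loop (.pop .V' (fun r o => { r with c := o }) .halt) (fun r => r.c.isSome)
    (atom (.push .V (fun r => g (r.c.getD default)) .halt))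

/-- Write the row of a point, moving `V` to `V'`. -/
def emitRow (f : Cell → Bool × Bool) : Prog Alph Reg :=
  loop (.pop .V (fun r o => { r with c := o }) .halt) (fun r => r.c.isSome)
    (atom (.push .V' (fun r => r.c.getD default) <|
      .push .A (fun r => .inr (f (r.c.getD default))) <|
      .push .B (fun r => .inr (f (r.c.getD default))) .halt))

/-- Write a point of kind `h`. -/
def emit (h : Kind) (f : Cell → Bool × Bool) (g : Cell → Cell) : Prog Alph Reg :=
  seq (atom (.push .A (fun _ => .inl (h, false)) <| .push .B (fun _ => .inl (h, false)) <|
    .push .N (fun _ => ()) .halt)) (seq (emitRow f) (restore g))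

theorem runs_restore (g : Cell → Cell) (l : List Cell) (r : Reg) (m : Mem) :
    Runs (restore g) (r, { m with V' := l }.stk)
      ({ r with c := none }, { m with V' := [], V := (l.map g).reverse ++ m.V }.stk)
      (2 * l.length + 1) := by
  induction l generalizing r m with
  | nil => exact Runs.loop_exit (by simp [exec]) rfl
  | cons a l ih =>
    refine (Runs.loop_step (s' := ({ r with c := some a }, { m with V' := l }.stk)) ?_ rfl
      (runs_atom' ?_) (ih { r with c := some a } { m with V := g a :: m.V })).cast ?_ ?_
    · simp [exec]
    · simp [exec]
    · simp
    · simp; omega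

/-- Popping `V` while pushing reverses the order, so rows are stored from the last variable to the
first; `Label.pt` reverses its row for this reason. -/
theorem runs_emitRow (f : Cell → Bool × Bool) (l : List Cell) (r : Reg) (m : Mem) :
    Runs (emitRow f) (r, { m with V := l }.stk)
      ({ r with c := none }, { m with
        V := [], V' := l.reverse ++ m.V'
        A := (l.map f).reverse.map Sum.inr ++ m.A
        B := (l.map f).reverse.map Sum.inr ++ m.B }.stk)
      (2 * l.length + 1) := by
  induction l generalizing r m with
  | nil => exact Runs.loop_exit (by simp [exec]) rfl
  | cons a l ih =>
    refine (Runs.loop_step (s' := ({ r with c := some a }, { m with V := l }.stk)) ?_ rfl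
      (runs_atom' ?_) (ih { r with c := some a } { m with
        V' := a :: m.V', A := .inr (f a) :: m.A, B := .inr (f a) :: m.B })).cast ?_ ?_
    · simp [exec]
    · simp [exec]
    · simp
    · simp; omega

theorem runs_emit (h : Kind) (f : Cell → Bool × Bool) (g : Cell → Cell) (r : Reg) (m : Mem)
    (hm : m.V' = []) :
    Runs (emit h f g) (r, m.stk)
      ({ r with c := none }, { m with
        V := m.V.map g
        A := Pt.rec false (h, (m.V.map f).reverse) ++ m.A
        B := Pt.rec false (h, (m.V.map f).reverse) ++ m.B
        N := () :: m.N }.stk)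
      (4 * m.V.length + 3) := by
  refine ((runs_atom' ?_).seq' rfl ((runs_emitRow f m.V r { m with
    A := .inl (h, false) :: m.A, B := .inl (h, false) :: m.B, N := () :: m.N }).seq' ?_
    (runs_restore g m.V.reverse { r with c := none } { m with
      V := [], V' := []
      A := Pt.rec false (h, (m.V.map f).reverse) ++ m.A
      B := Pt.rec false (h, (m.V.map f).reverse) ++ m.B
      N := () :: m.N }))).cast ?_ ?_
  · simp [exec]
  · simp [Pt.rec, hm]
  · simp [hm]
  · simp; omega

end SatToMedian

/-! ### Reading the formula -/

namespace SatToMedian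

open Turing StackProgram

/-- The points of the instance built from a formula. -/
inductive Label (n : ℕ)
  | z | w | w'
  | lit (v : Fin n) (b : Bool)
  | tt (v : Fin n)
  | cl (c : List (Fin n × Bool))

namespace Label

variable {n : ℕ}

/-- The kind of a point. -/
def kind : Label n → Kind
  | z => .z
  | w => .w
  | w' => .w'
  | lit _ _ => .lit
  | tt _ => .tt
  | cl _ => .cl

/-- The literals a point stands for. -/
def row : Label n → Fin n → Bool × Bool
  | z, _ => (false, false)
  | w, _ => (false, false)
  | w', _ => (false, false)
  | lit v b, j => if j = v then (b, !b) else (false, false)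
  | tt v, j => if j = v then (true, true) else (false, false)
  | cl c, j => (decide ((j, true) ∈ c), decide ((j, false) ∈ c))

/-- The point as the machine represents it. -/
def pt (a : Label n) : Pt := (a.kind, ((List.finRange n).map a.row).reverse)

@[simp] theorem length_pt (a : Label n) : a.pt.2.length = n := by simp [pt]

end Label

/-- The stored form of a list of points. -/
def recs {n : ℕ} (ls : List (Label n)) : List RSym := ls.flatMap fun a => Pt.rec false a.pt

/-- Read a number in unary, and write as many empty cells. -/
def readVars : Prog Alph Reg :=
  loop (.pop .inp (fun r o => { r with i := o }) .halt) (fun r => r.i == some (some true))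
    (atom (.push .V (fun _ => default) .halt))

/-- Read a number in unary, and move as many cells from `V` to `V'`. -/
def walk : Prog Alph Reg :=
  loop (.pop .inp (fun r o => { r with i := o }) .halt) (fun r => r.i == some (some true))
    (atom (.pop .V (fun r o => { r with c := o }) <|
      .push .V' (fun r => r.c.getD default) .halt))

/-- Record an occurrence. -/
def Cell.mark (b : Bool) (c : Cell) : Cell := ⟨c.pos || b, c.neg || !b, true, true⟩

/-- Forget which variable has just been read. -/
def Cell.uncur (c : Cell) : Cell := { c with cur := false }

/-- Forget the current clause. -/
def Cell.clear (c : Cell) : Cell := { c with pos := false, neg := false }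

/-- Read the variable of a literal and mark its cell. -/
def markLit : Prog Alph Reg :=
  seq (atom (.load (fun r => { r with sgn := r.i.join.getD false }) .halt)) <|
  seq walk <|
  seq (atom (.pop .V (fun r o => { r with c := o }) <|
      .push .V (fun r => (r.c.getD default).mark r.sgn) .halt)) <|
  restore id

/-- Process a literal. -/
def readLit : Prog Alph Reg :=
  seq markLit <|
  seq (emit .lit (fun c => (c.cur, false)) id) <|
  seq (emit .lit (fun c => (false, c.cur)) id) <|
  emit .tt (fun c => (c.cur, c.cur)) Cell.uncur

/-- Process the end of a clause. -/
def readSep : Prog Alph Reg := emit .cl (fun c => (c.pos, c.neg)) Cell.clear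

/-- Process the clauses. -/
def readClauses : Prog Alph Reg :=
  loop (.pop .inp (fun r o => { r with i := o }) .halt) (fun r => r.i.isSome)
    (ite (fun r => r.i == some none) readSep readLit)

/-! ### Correctness and time of the parser. -/

theorem runs_readVars (n : ℕ) (rest : List (Option Bool)) (r : Reg) (m : Mem) :
    Runs readVars (r, { m with inp := encUnary n ++ rest }.stk)
      ({ r with i := some none },
        { m with inp := rest, V := List.replicate n default ++ m.V }.stk) (2 * n + 1) := by
  induction n generalizing r m with
  | zero => exact Runs.loop_exit (by simp [exec, encUnary]) rfl
  | succ n ih =>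
    refine (Runs.loop_step
      (s' := ({ r with i := some (some true) }, { m with inp := encUnary n ++ rest }.stk)) ?_ rfl
      (runs_atom' ?_) (ih { r with i := some (some true) } { m with V := default :: m.V })).cast
      ?_ ?_
    · simp [exec, encUnary, List.replicate_succ]
    · simp [exec]
    · simp [List.replicate_succ']
    · omega

theorem runs_walk (l l' : List Cell) (rest : List (Option Bool)) (r : Reg) (m : Mem) :
    ∃ o, Runs walk (r, { m with inp := encUnary l.length ++ rest, V := l ++ l' }.stk)
      ({ r with i := some none, c := o },
        { m with inp := rest, V := l', V' := l.reverse ++ m.V' }.stk) (2 * l.length + 1) := by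
  induction l generalizing r m with
  | nil => exact ⟨r.c, Runs.loop_exit (by simp [exec, encUnary]) rfl⟩
  | cons a l ih =>
    obtain ⟨o, h⟩ := ih { r with i := some (some true), c := some a } { m with V' := a :: m.V' }
    refine ⟨o, (Runs.loop_step
      (s' := ({ r with i := some (some true) },
        { m with inp := encUnary l.length ++ rest, V := a :: l ++ l' }.stk)) ?_ rfl
      (runs_atom' ?_) h).cast ?_ ?_⟩
    · simp [exec, encUnary, List.replicate_succ]
    · simp [exec]
    · simp
    · simp; omega

theorem runs_markLit (l l' : List Cell) (a : Cell) (b : Bool) (rest : List (Option Bool))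
    (r : Reg) (m : Mem) (hm : m.V' = []) (hr : r.i = some (some b)) :
    ∃ r', Runs markLit (r, { m with inp := encUnary l.length ++ rest, V := l ++ a :: l' }.stk)
      (r', { m with inp := rest, V := l ++ a.mark b :: l' }.stk) (4 * l.length + 4) := by
  obtain ⟨o, h⟩ := runs_walk l (a :: l') rest { r with sgn := b } m
  refine ⟨{ r with i := some none, sgn := b, c := none }, ((runs_atom' ?_).seq' rfl (h.seq' rfl ((runs_atom' rfl).seq' ?_
    (runs_restore id l.reverse { r with i := some none, sgn := b, c := some a }
      { m with inp := rest, V := a.mark b :: l' })))).cast ?_ ?_⟩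
  · simp [exec, hr]
  · simp [exec, hm]
  · simp [hm]
  · simp; omega

/-- Isolates the cell that is reached after walking `v` positions; the last two clauses say that no
other cell belongs to `v`. -/
theorem finRange_eq_append_cons {n : ℕ} (v : Fin n) :
    ∃ l l', List.finRange n = l ++ v :: l' ∧ l.length = v ∧ v ∉ l ∧ v ∉ l' := by
  refine ⟨(List.finRange n).take v, (List.finRange n).drop (v + 1), ?_, by simp, ?_, ?_⟩
  · conv_lhs => rw [← List.take_append_drop v (List.finRange n)]
    rw [List.drop_eq_getElem_cons (by simp)]
    simp
  · intro h
    obtain ⟨i, hi, h⟩ := List.mem_iff_getElem.1 h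
    have := congrArg Fin.val h
    simp at hi this
    omega
  · intro h
    obtain ⟨i, hi, h⟩ := List.mem_iff_getElem.1 h
    have := congrArg Fin.val h
    simp at this
    omega

/-- The parts of the text of a formula. -/
abbrev Token (n : ℕ) : Type := Option (Fin n × Bool)

/-- The text of a part of a formula. -/
def Token.encode {n : ℕ} : Token n → List (Option Bool)
  | some l => some l.2 :: encUnary l.1
  | none => [none]

/-- The current clause, the literals read so far, and the points written so far. -/
abbrev ReadState (n : ℕ) : Type :=
  List (Fin n × Bool) × List (Fin n × Bool) × List (Label n)

/-- The effect of reading a part of a formula. -/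
def ReadState.next {n : ℕ} (s : ReadState n) : Token n → ReadState n
  | some l => (l :: s.1, l :: s.2.1, .tt l.1 :: .lit l.1 false :: .lit l.1 true :: s.2.2)
  | none => ([], s.2.1, .cl s.1 :: s.2.2)

/-- The cell of a variable. -/
def ReadState.cell {n : ℕ} (s : ReadState n) (j : Fin n) : Cell :=
  ⟨decide ((j, true) ∈ s.1), decide ((j, false) ∈ s.1), false,
    decide ((j, true) ∈ s.2.1 ∨ (j, false) ∈ s.2.1)⟩

/-- The contents of the stacks while the formula is being read. -/
def ReadState.mem {n : ℕ} (s : ReadState n) (inp : List (Option Bool)) : Mem where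
  inp := inp
  V := (List.finRange n).map s.cell
  A := recs s.2.2
  B := recs s.2.2
  N := List.replicate s.2.2.length ()

/-- One lemma for all kinds of points: the machine writes the right row as soon as `f` extracts it
from the current cells. Both copies of the list, on `A` and on `B`, grow together. -/
theorem runs_emit_label {n : ℕ} (a : Label n) (f : Cell → Bool × Bool) (g : Cell → Cell)
    (F : Fin n → Cell) (ls : List (Label n)) (r : Reg) (m : Mem)
    (hf : ∀ j, f (F j) = a.row j) (hm : m.V' = []) :
    Runs (emit a.kind f g) (r, { m with
        V := (List.finRange n).map F, A := recs ls, B := recs ls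
        N := List.replicate ls.length () }.stk)
      ({ r with c := none }, { m with
        V := (List.finRange n).map (fun j => g (F j)), A := recs (a :: ls), B := recs (a :: ls)
        N := List.replicate (a :: ls).length () }.stk)
      (4 * n + 3) := by
  refine (runs_emit a.kind f g r _ ?_).cast ?_ ?_
  · exact hm
  · have : (fun j => f (F j)) = a.row := funext hf
    simp [recs, Label.pt, List.replicate_succ, this, Function.comp_def]
  · simp

theorem runs_readSep {n : ℕ} (s : ReadState n) (inp : List (Option Bool)) (r : Reg) :
    Runs readSep (r, (s.mem inp).stk) ({ r with c := none }, ((s.next none).mem inp).stk)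
      (4 * n + 3) := by
  have e : (fun j => Cell.clear (s.cell j)) = (s.next none).cell := by
    funext j
    simp only [Cell.clear, ReadState.cell, ReadState.next, List.not_mem_nil, decide_false]
    rfl
  refine (runs_emit_label (.cl s.1) _ _ s.cell s.2.2 r { inp := inp } (fun _ => rfl) rfl).cast
    ?_ le_rfl
  rw [e]; rfl

theorem runs_readLit {n : ℕ} (s : ReadState n) (l : Fin n × Bool) (inp : List (Option Bool))
    (r : Reg) (hr : r.i = some (some l.2)) :
    ∃ r', Runs readLit (r, (s.mem (encUnary l.1 ++ inp)).stk)
      (r', ((s.next (some l)).mem inp).stk) (16 * n + 13) := by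
  obtain ⟨v, b⟩ := l
  obtain ⟨l₁, l₂, hl, hlen, h₁, h₂⟩ := finRange_eq_append_cons v
  obtain ⟨r', h⟩ := runs_markLit (l₁.map s.cell) (l₂.map s.cell) (s.cell v) b inp r
    (s.mem inp) rfl hr
  -- The cells after the literal has been marked and before its points are written.
  set F : Fin n → Cell := fun j => if j = v then (s.cell j).mark b else s.cell j with hF
  have hV : l₁.map s.cell ++ (s.cell v).mark b :: l₂.map s.cell = (List.finRange n).map F := by
    rw [hl]
    simp only [List.map_append, List.map_cons, hF, if_true]
    congr 1
    · refine List.map_congr_left fun j hj => ?_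
      rw [if_neg]; rintro rfl; exact h₁ hj
    · congr 1
      refine List.map_congr_left fun j hj => ?_
      rw [if_neg]; rintro rfl; exact h₂ hj
  -- No cell is current between two tokens, so the mark singles out `v`, and `cur` alone suffices to
  -- write the rows of its three points.
  have hcur : ∀ j, (F j).cur = decide (j = v) := by
    intro j
    by_cases hj : j = v <;> simp [hF, hj, Cell.mark, ReadState.cell]
  have e1 := runs_emit_label (.lit v true) (fun c => (c.cur, false)) id F s.2.2 r'
    { inp := inp } (fun j => by
      by_cases hj : j = v <;> simp [hcur, hj, Label.row]) rfl
  have e2 := runs_emit_label (.lit v false) (fun c => (false, c.cur)) id F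
    (.lit v true :: s.2.2) { r' with c := none } { inp := inp } (fun j => by
      by_cases hj : j = v <;> simp [hcur, hj, Label.row]) rfl
  have e3 := runs_emit_label (.tt v) (fun c => (c.cur, c.cur)) Cell.uncur F
    (.lit v false :: .lit v true :: s.2.2) { r' with c := none } { inp := inp } (fun j => by
      by_cases hj : j = v <;> simp [hcur, hj, Label.row]) rfl
  refine ⟨{ r' with c := none }, Runs.cast (Runs.seq' (t := 4 * n + 4) (s := (r, (s.mem (encUnary v ++ inp)).stk))
    (s' := (r', { s.mem inp with
      inp := inp, V := l₁.map s.cell ++ (s.cell v).mark b :: l₂.map s.cell }.stk))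
    ?_ ?_ (e1.seq' ?_ (e2.seq' ?_ e3))) ?_ ?_⟩
  · have hs : (s.mem (encUnary v ++ inp)) = { s.mem inp with
        inp := encUnary (l₁.map s.cell).length ++ inp
        V := l₁.map s.cell ++ s.cell v :: l₂.map s.cell } := by
      simp [ReadState.mem, hl, hlen]
    rw [hs]
    refine h.mono ?_
    simp [hlen]
  · rw [hV]; rfl
  · simp
  · simp
  · simp only [Prod.mk.injEq, true_and]
    simp only [ReadState.mem, ReadState.next]
    congr 2
    -- Emitting the `tt` point has cleared `cur`; what remains must be the cells prescribed by
    -- `ReadState.next`.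
    refine List.map_congr_left fun j _ => ?_
    by_cases hj : j = v
    · subst hj
      cases b <;> simp [hF, Cell.uncur, Cell.mark, ReadState.cell]
    · simp [hF, hj, Cell.uncur, ReadState.cell]
  · omega

theorem runs_readClauses {n : ℕ} (ts : List (Token n)) (s : ReadState n) (r : Reg) :
    ∃ r', Runs readClauses (r, (s.mem (ts.flatMap Token.encode)).stk)
      (r', ((ts.foldl ReadState.next s).mem []).stk) ((16 * n + 15) * ts.length + 1) := by
  induction ts generalizing s r with
  | nil => exact ⟨_, Runs.loop_exit (by simp [exec, ReadState.mem]; rfl) rfl⟩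
  | cons t ts ih =>
    cases t with
    | none =>
      obtain ⟨r', h⟩ := ih (s.next none) { r with i := some none, c := none }
      refine ⟨r', (Runs.loop_step
        (s' := ({ r with i := some none }, (s.mem (ts.flatMap Token.encode)).stk)) ?_ rfl
        (Runs.ite_true rfl
          (runs_readSep s (ts.flatMap Token.encode) { r with i := some none })) h).cast rfl ?_⟩
      · simp [exec, ReadState.mem, Token.encode]
      · simp only [List.length_cons, mul_add]; omega
    | some l =>
      obtain ⟨r₁, h₁⟩ := runs_readLit s l (ts.flatMap Token.encode)
        { r with i := some (some l.2) } rfl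
      obtain ⟨r', h⟩ := ih (s.next (some l)) r₁
      refine ⟨r', (Runs.loop_step
        (s' := ({ r with i := some (some l.2) },
          (s.mem (encUnary l.1 ++ ts.flatMap Token.encode)).stk)) ?_ rfl
        (Runs.ite_false rfl h₁) h).cast rfl ?_⟩
      · simp [exec, ReadState.mem, Token.encode]
      · simp only [List.length_cons, mul_add]; omega

end SatToMedian

/-! ### Writing the instance -/

namespace SatToMedian

open Turing StackProgram

/-- The distance of two distinct points of the given kinds; `i` says whether the literals they stand
for intersect. -/
def kdist : Kind → Kind → Bool → ℕ
  | .z, .cl, _ | .cl, .z, _ | .z, .w, _ | .w, .z, _ | .w, .w', _ | .w', .w, _ => 4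
  | .w, .w, _ | .lit, .lit, _ => 4
  | .z, .w', _ | .w', .z, _ => 5
  | .lit, .tt, i | .tt, .lit, i | .lit, .cl, i | .cl, .lit, i => if i then 4 else 6
  | _, _, _ => 6

/-- Whether two sets of literals of one variable intersect. -/
def meet (a b : Bool × Bool) : Bool := (a.1 && b.1) || (a.2 && b.2)

/-- Whether two rows intersect. -/
def meetRows (a b : List (Bool × Bool)) : Bool := (a.zip b).any fun p => meet p.1 p.2

/-- The distance of two distinct points. -/
def Pt.dist (p q : Pt) : ℕ := kdist p.1 q.1 (meetRows p.2 q.2)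

/-- The code of a number from `0, 4, 5, 6`. -/
def distWord (d : ℕ) : List (Option Bool) :=
  (if d = 0 then [] else [some (d == 5), some (d == 6), some true]) ++ [none, some true, none]

/-- The pair of bits in a symbol. -/
def RSym.bits : Option RSym → Bool × Bool
  | some (.inr p) => p
  | _ => (false, false)

/-- The kind and the mark in a symbol. -/
def RSym.head : Option RSym → Kind × Bool
  | some (.inl p) => p
  | _ => (.z, false)

/-- Whether a symbol is a pair of bits. -/
def RSym.isBits : Option RSym → Bool
  | some (.inr _) => true
  | _ => false

/-- Compare the rows on top of `A` and of `B`. -/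
def zipRows : Prog Alph Reg :=
  loop (.pop .A (fun r o => { r with x := o }) <| .pop .B (fun r o => { r with y := o }) .halt)
    (fun r => RSym.isBits r.y)
    (atom (.load (fun r =>
        { r with inter := r.inter || meet (RSym.bits r.x) (RSym.bits r.y) }) <|
      .push .X (fun r => .inr (RSym.bits r.x)) <| .push .B' (fun r => .inr (RSym.bits r.y)) .halt))

/-- Move `X` back to `A`. -/
def restoreX : Prog Alph Reg :=
  loop (.pop .X (fun r o => { r with x := o }) .halt) (fun r => r.x.isSome)
    (atom (.push .A (fun r => .inr (RSym.bits r.x)) .halt))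

/-- Move `B'` back to `B`. -/
def restoreB : Prog Alph Reg :=
  loop (.pop .B' (fun r o => { r with y := o }) .halt) (fun r => r.y.isSome)
    (atom (.push .B (fun r => r.y.getD (.inr default)) .halt))

/-- Remove the point on top of `A`. -/
def dropA : Prog Alph Reg :=
  loop (.pop .A (fun r o => { r with x := o }) .halt) (fun r => RSym.isBits r.x) (atom .halt)

/-- The distance held in the registers. -/
def Reg.dist (r : Reg) : ℕ := kdist (RSym.head r.x).1 (RSym.head r.y).1 r.inter

/-- Write the varying part of a distance, unless it is that of a point from itself. -/
def writeBits : Prog Alph Reg :=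
  ite (fun r => !r.seen && !(RSym.head r.y).2) (atom .halt)
    (atom (.push .O (fun r => some (r.dist == 5)) <| .push .O (fun r => some (r.dist == 6)) <|
      .push .O (fun _ => some true) .halt))

/-- Write the distance of the points on top of `A` and `B`, and move the latter to `B'`. -/
def writeEntry : Prog Alph Reg :=
  seq zipRows <|
  seq writeBits <|
  seq (atom (.push .B' (fun r => .inl ((RSym.head r.y).1, (RSym.head r.y).2 || !r.seen)) <|
    .push .A (fun r => .inl (RSym.head r.x)) <|
    .load (fun r => { r with seen := r.seen || !(RSym.head r.y).2 }) <|
    .push .O (fun _ => none) <| .push .O (fun _ => some true) <| .push .O (fun _ => none) .halt)) <|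
  restoreX

/-- Write the distances of the point on top of `A`. -/
def writeRow : Prog Alph Reg :=
  loop (.peek .B (fun r o => { r with y := o, inter := false }) .halt) (fun r => r.y.isSome)
    writeEntry

/-- Write the matrix of distances. -/
def writeMatrix : Prog Alph Reg :=
  loop (.peek .A (fun r o => { r with x := o, seen := false }) .halt) (fun r => r.x.isSome)
    (seq writeRow (seq restoreB dropA))

/-! ### Correctness and time of writing the matrix. -/

theorem runs_restoreX (l : List (Bool × Bool)) (r : Reg) (m : Mem) :
    Runs restoreX (r, { m with X := l.map Sum.inr }.stk)
      ({ r with x := none }, { m with X := [], A := l.reverse.map Sum.inr ++ m.A }.stk)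
      (2 * l.length + 1) := by
  induction l generalizing r m with
  | nil => exact Runs.loop_exit (by simp [exec]) rfl
  | cons a l ih =>
    refine (Runs.loop_step (s' := ({ r with x := some (.inr a) },
        { m with X := l.map Sum.inr }.stk)) ?_ rfl
      (runs_atom' ?_) (ih { r with x := some (.inr a) } { m with A := .inr a :: m.A })).cast ?_ ?_
    · simp [exec]
    · simp [exec, RSym.bits]
    · simp
    · simp; omega

theorem runs_restoreB (l : List RSym) (r : Reg) (m : Mem) :
    Runs restoreB (r, { m with B' := l }.stk)
      ({ r with y := none }, { m with B' := [], B := l.reverse ++ m.B }.stk)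
      (2 * l.length + 1) := by
  induction l generalizing r m with
  | nil => exact Runs.loop_exit (by simp [exec]) rfl
  | cons a l ih =>
    refine (Runs.loop_step (s' := ({ r with y := some a }, { m with B' := l }.stk)) ?_ rfl
      (runs_atom' ?_) (ih { r with y := some a } { m with B := a :: m.B })).cast ?_ ?_
    · simp [exec]
    · simp [exec]
    · simp
    · simp; omega

theorem runs_dropA (p : Pt) (v : Bool) (rest : List RSym) (r : Reg) (m : Mem) :
    Runs dropA (r, { m with A := Pt.rec v p ++ rest }.stk)
      ({ r with x := some (.inl (p.1, v)) }, { m with A := rest }.stk) (2 * p.2.length + 1) := by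
  obtain ⟨k, l⟩ := p
  induction l generalizing r with
  | nil => exact Runs.loop_exit (by simp [exec, Pt.rec]) rfl
  | cons a l ih =>
    refine (Runs.loop_step (s' := ({ r with x := some (.inr a) },
        { m with A := Pt.rec v (k, l) ++ rest }.stk)) ?_ rfl
      (runs_atom' ?_) (ih { r with x := some (.inr a) })).cast ?_ ?_
    · simp [exec, Pt.rec]
    · rfl
    · simp
    · simp; omega

/-- The row from `A` is kept on `X` since it is needed for the next column; the row from `B` goes to
`B'`, where the whole list is collected until the end of the matrix row. -/
theorem runs_zipRows (a b : List (Bool × Bool)) (h : a.length = b.length) (s t : Kind × Bool)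
    (A B : List RSym) (r : Reg) (m : Mem) :
    Runs zipRows (r, { m with
        A := a.map Sum.inr ++ Sum.inl s :: A
        B := b.map Sum.inr ++ Sum.inl t :: B }.stk)
      ({ r with x := some (.inl s), y := some (.inl t), inter := r.inter || meetRows a b },
        { m with A := A, B := B, X := a.reverse.map Sum.inr ++ m.X
                 B' := b.reverse.map Sum.inr ++ m.B' }.stk)
      (2 * a.length + 1) := by
  induction a generalizing b r m with
  | nil =>
    obtain rfl : b = [] := by simpa using h.symm
    exact Runs.loop_exit (by simp [exec, meetRows]) rfl
  | cons x a ih =>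
    obtain ⟨y, b, rfl⟩ := List.exists_cons_of_length_eq_add_one h.symm
    refine (Runs.loop_step (s' := ({ r with x := some (.inr x), y := some (.inr y) }, { m with
        A := a.map Sum.inr ++ Sum.inl s :: A
        B := b.map Sum.inr ++ Sum.inl t :: B }.stk)) ?_ rfl
      (runs_atom' ?_) (ih b (by simpa using h)
        { r with x := some (.inr x), y := some (.inr y), inter := r.inter || meet x y }
        { m with X := .inr x :: m.X, B' := .inr y :: m.B' })).cast ?_ ?_
    · simp [exec]
    · simp [exec, RSym.bits]
    · simp [meetRows, Bool.or_assoc]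
    · simp; omega

theorem Pt.rec_append (v : Bool) (p : Pt) (l : List RSym) :
    Pt.rec v p ++ l = p.2.map Sum.inr ++ Sum.inl (p.1, v) :: l := by
  simp [Pt.rec]

/-- The diagonal is recognized without counting: it is the first unmarked point of `B`, that is, the
mark `v` and the register `seen` are both false. It gets distance 0 and is marked, so that the next
row finds its diagonal one place further on. -/
theorem runs_writeEntry (p q : Pt) (h : p.2.length = q.2.length) (v : Bool) (A B : List RSym)
    (r : Reg) (m : Mem) (hX : m.X = []) (hr : r.inter = false) :
    ∃ r', r'.seen = (r.seen || !v) ∧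
      Runs writeEntry (r, { m with A := Pt.rec false p ++ A, B := Pt.rec v q ++ B }.stk)
        (r', { m with
          A := Pt.rec false p ++ A, B := B, B' := (Pt.rec (v || !r.seen) q).reverse ++ m.B'
          O := (distWord (if !r.seen && !v then 0 else p.dist q)).reverse ++ m.O }.stk)
        (4 * p.2.length + 6) := by
  obtain ⟨i, a⟩ := p
  obtain ⟨j, b⟩ := q
  have h1 := runs_zipRows a b h (i, false) (j, v) A B r m
  have h2 : Runs writeBits
      ({ r with x := some (.inl (i, false)), y := some (.inl (j, v)),
                inter := r.inter || meetRows a b },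
        { m with A := A, B := B, X := a.reverse.map Sum.inr ++ m.X
                 B' := b.reverse.map Sum.inr ++ m.B' }.stk)
      ({ r with x := some (.inl (i, false)), y := some (.inl (j, v)),
                inter := r.inter || meetRows a b },
        { m with A := A, B := B, X := a.reverse.map Sum.inr ++ m.X
                 B' := b.reverse.map Sum.inr ++ m.B'
                 O := (if !r.seen && !v then [] else
                   [some true, some (Pt.dist (i, a) (j, b) == 6),
                     some (Pt.dist (i, a) (j, b) == 5)]) ++ m.O }.stk) 2 := by
    by_cases hc : (!r.seen && !v) = true
    · refine Runs.ite_true hc (runs_atom' ?_)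
      simp [exec, hc]
    · refine Runs.ite_false (by simpa [RSym.head] using hc) (runs_atom' ?_)
      rw [if_neg hc]
      simp [exec, Reg.dist, RSym.head, Pt.dist, hr]
  refine ⟨{ r with x := none, y := some (.inl (j, v)), inter := r.inter || meetRows a b,
                   seen := r.seen || !v }, rfl, ?_⟩
  rw [Pt.rec_append, Pt.rec_append]
  refine (h1.seq (h2.seq ((runs_atom' rfl).seq' ?_ (runs_restoreX a.reverse
    { r with x := some (.inl (i, false)), y := some (.inl (j, v)),
             inter := r.inter || meetRows a b, seen := r.seen || !v }
    { m with
          A := .inl (i, false) :: A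
          B := B
          B' := (Pt.rec (v || !r.seen) (j, b)).reverse ++ m.B'
          O := (distWord (if !r.seen && !v then 0 else Pt.dist (i, a) (j, b))).reverse ++ m.O
          })))).cast ?_ ?_
  · have hd : Pt.dist (i, a) (j, b) ≠ 0 := by
      simp only [Pt.dist]
      cases i <;> cases j <;> simp [kdist] <;> split <;> simp
    by_cases hc : (!r.seen && !v) = true
    · rw [if_pos hc, if_pos hc]
      simp [exec, RSym.head, Pt.rec, distWord, hX]
    · rw [if_neg hc, if_neg hc]
      simp [exec, RSym.head, Pt.rec, distWord, hX, hd]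
  · simp [hX, Pt.rec]
  · simp; omega

/-- The row of distances of `p`; in the list of the points, those up to the diagonal are marked. -/
def rowWord (p : Pt) : Bool → List (Bool × Pt) → List (Option Bool)
  | _, [] => []
  | s, q :: l =>
    distWord (if !s && !q.1 then 0 else p.dist q.2) ++ rowWord p (s || !q.1) l

/-- The new marks of the list of the points. -/
def rowMark : Bool → List (Bool × Pt) → List (Bool × Pt)
  | _, [] => []
  | s, q :: l => (q.1 || !s, q.2) :: rowMark (s || !q.1) l

/-- The stored form of a list of marked points. -/
def mrecs (l : List (Bool × Pt)) : List RSym := l.flatMap fun q => Pt.rec q.1 q.2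

theorem runs_writeRow (n : ℕ) (p : Pt) (hp : p.2.length = n) (A : List RSym)
    (l : List (Bool × Pt)) (hl : ∀ q ∈ l, q.2.2.length = n) (r : Reg) (m : Mem) (hX : m.X = []) :
    ∃ r', Runs writeRow (r, { m with A := Pt.rec false p ++ A, B := mrecs l }.stk)
        (r', { m with
          A := Pt.rec false p ++ A, B := [], B' := (mrecs (rowMark r.seen l)).reverse ++ m.B'
          O := (rowWord p r.seen l).reverse ++ m.O }.stk)
        (l.length * (4 * n + 7) + 1) := by
  induction l generalizing r m with
  | nil =>
    exact ⟨{ r with y := none, inter := false }, Runs.mono (Runs.loop_exit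
      (by simp [exec, mrecs, rowMark, rowWord]) rfl) (by simp)⟩
  | cons q l ih =>
    obtain ⟨v, q⟩ := q
    have hq : q.2.length = n := hl (v, q) (by simp)
    obtain ⟨r₁, hs, h₁⟩ := runs_writeEntry p q (hp.trans hq.symm) v A (mrecs l)
      { r with y := (mrecs ((v, q) :: l)).head?, inter := false } m hX rfl
    obtain ⟨r', h⟩ := ih (fun x hx => hl x (List.mem_cons_of_mem _ hx)) r₁ { m with
      B' := (Pt.rec (v || !r.seen) q).reverse ++ m.B'
      O := (distWord (if !r.seen && !v then 0 else p.dist q)).reverse ++ m.O } hX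
    refine ⟨r', (Runs.loop_step (s' := ({ r with
      y := (mrecs ((v, q) :: l)).head?, inter := false }, _)) ?_ ?_ h₁ h).cast ?_ ?_⟩
    · simp [exec, mrecs]
    · simp [mrecs, Pt.rec]
    · simp only at hs
      simp [hs, mrecs, rowMark, rowWord]
    · rw [List.length_cons, add_mul, hp]; omega

/-- The matrix of distances; the points in `done` have been processed. -/
def matrixWord : List Pt → List Pt → List (Option Bool)
  | _, [] => []
  | done, p :: l =>
    rowWord p false (done.map (true, ·) ++ (p :: l).map (false, ·)) ++ matrixWord (done ++ [p]) l

theorem rowMark_true (l : List Pt) : rowMark true (l.map (false, ·)) = l.map (false, ·) := by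
  induction l with
  | nil => rfl
  | cons a l ih => simpa [rowMark] using ih

/-- A marked prefix stays marked, the first unmarked point becomes marked, and nothing changes after
it: the invariant passing from one matrix row to the next. -/
theorem rowMark_append (done : List Pt) (p : Pt) (l : List Pt) :
    rowMark false (done.map (true, ·) ++ (p :: l).map (false, ·)) =
      (done ++ [p]).map (true, ·) ++ l.map (false, ·) := by
  induction done with
  | nil => simpa [rowMark] using rowMark_true l
  | cons a done ih => simpa [rowMark] using ih

theorem length_mrecs (n : ℕ) (l : List (Bool × Pt)) (hl : ∀ q ∈ l, q.2.2.length = n) :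
    (mrecs l).length = l.length * (n + 1) := by
  induction l with
  | nil => simp [mrecs]
  | cons q l ih =>
    have := ih (fun x hx => hl x (List.mem_cons_of_mem _ hx))
    have := hl q (by simp)
    simp_all [mrecs, Pt.rec, add_mul]
    omega

/-- The induction runs over the points still on `A`, while `B` always holds all `N` points, the
processed ones marked. Each round costs one pass over `B`, its restoration, and the removal of one
point from `A`. -/
theorem runs_writeMatrix (n N : ℕ) (done l : List Pt) (hN : done.length + l.length = N)
    (hl : ∀ q ∈ done ++ l, q.2.length = n) (r : Reg) (m : Mem) (hX : m.X = []) (hB' : m.B' = []) :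
    ∃ r', Runs writeMatrix (r, { m with
          A := l.flatMap (Pt.rec false), B := mrecs (done.map (true, ·) ++ l.map (false, ·)) }.stk)
        (r', { m with A := [], B := mrecs ((done ++ l).map (true, ·))
                      O := (matrixWord done l).reverse ++ m.O }.stk)
        (l.length * (N * (6 * n + 9) + 2 * n + 4) + 1) := by
  induction l generalizing done r m with
  | nil =>
    exact ⟨{ r with x := none, seen := false }, Runs.mono (Runs.loop_exit
      (by simp [exec, matrixWord]) rfl) (by simp)⟩
  | cons p l ih =>
    have hp : p.2.length = n := hl p (by simp)
    have hlen : ∀ q ∈ done.map (true, ·) ++ (p :: l).map (false, ·), q.2.2.length = n := by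
      intro q hq
      simp only [List.mem_append, List.mem_map] at hq
      obtain ⟨a, ha, rfl⟩ | ⟨a, ha, rfl⟩ := hq
      · exact hl a (by simp [ha])
      · exact hl a (List.mem_append_right _ ha)
    have hlen' : ∀ q ∈ (done ++ [p]).map (true, ·) ++ l.map (false, ·), q.2.2.length = n := by
      intro q hq
      simp only [List.mem_append, List.mem_map] at hq
      obtain ⟨a, ha, rfl⟩ | ⟨a, ha, rfl⟩ := hq
      · exact hl a (by simp at ha ⊢; tauto)
      · exact hl a (by simp [ha])
    obtain ⟨r₁, h₁⟩ := runs_writeRow n p hp (l.flatMap (Pt.rec false)) _ hlen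
      { r with x := ((p :: l).flatMap (Pt.rec false)).head?, seen := false } m hX
    have h₂ := runs_restoreB (mrecs ((done ++ [p]).map (true, ·) ++ l.map (false, ·))).reverse r₁
      { m with A := Pt.rec false p ++ l.flatMap (Pt.rec false), B := []
               O := (rowWord p false
                (done.map (true, ·) ++ (p :: l).map (false, ·))).reverse ++ m.O }
    have h₃ := runs_dropA p false (l.flatMap (Pt.rec false)) { r₁ with y := none }
      { m with B := mrecs ((done ++ [p]).map (true, ·) ++ l.map (false, ·)), B' := []
               O := (rowWord p false
                (done.map (true, ·) ++ (p :: l).map (false, ·))).reverse ++ m.O }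
    obtain ⟨r', h⟩ := ih (done ++ [p]) (by simp at hN ⊢; omega) (by simpa using hl)
      { r₁ with y := none, x := some (.inl (p.1, false)) }
      { m with
        B' := []
        O := (rowWord p false
          (done.map (true, ·) ++ (p :: l).map (false, ·))).reverse ++ m.O } hX rfl
    refine ⟨r', (Runs.loop_step (s' := ({ r with
      x := ((p :: l).flatMap (Pt.rec false)).head?, seen := false }, _)) ?_ ?_
      (h₁.seq' ?_ (h₂.seq' ?_ h₃)) h).cast ?_ ?_⟩
    · simp [exec]
    · simp [Pt.rec]
    · dsimp only
      rw [rowMark_append]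
      simp [hB']
    · simp
    · simp [matrixWord, hB']
    · rw [List.length_reverse, length_mrecs n _ hlen', List.length_cons, add_mul, hp]
      have e1 : (done.map (fun x => (true, x)) ++ (p :: l).map (fun x => (false, x))).length = N := by
        simpa using hN
      have e2 : ((done ++ [p]).map (fun x => (true, x)) ++ l.map (fun x => (false, x))).length
          = N := by
        simp at hN ⊢; omega
      rw [e1, e2]
      ring_nf
      omega

end SatToMedian

/-! ### The reduction as a program -/

namespace SatToMedian

open Turing StackProgram

/-- Count the variables that have been used. -/
def countUsed : Prog Alph Reg :=
  loop (.pop .V (fun r o => { r with c := o }) .halt) (fun r => r.c.isSome)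
    (ite (fun r => (r.c.getD default).used)
      (atom (.push .K₁ (fun _ => ()) <| .push .K₂ (fun _ => ()) .halt)) (atom .halt))

/-- Write the number of points. -/
def writeN : Prog Alph Reg :=
  seq (loop (.pop .N (fun r o => { r with u := o }) .halt) (fun r => r.u.isSome)
    (atom (.push .O (fun _ => some true) .halt))) (atom (.push .O (fun _ => none) .halt))

/-- Write the number of centers. -/
def writeK : Prog Alph Reg :=
  seq (loop (.pop .K₁ (fun r o => { r with u := o }) .halt) (fun r => r.u.isSome)
    (atom (.push .O (fun _ => some true) .halt))) (atom (.push .O (fun _ => none) .halt))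

/-- Empty the stack `B`. -/
def dropB : Prog Alph Reg :=
  loop (.pop .B (fun r o => { r with y := o }) .halt) (fun r => r.y.isSome) (atom .halt)

/-- Write a point without literals. -/
def emitSpecial (h : Kind) : Prog Alph Reg := emit h (fun _ => (false, false)) id

/-- Turn a formula into an instance. -/
def reduce : Prog Alph Reg :=
  seq readVars <| seq readClauses <| seq (emitSpecial .w') <| seq (emitSpecial .w) <|
  seq (emitSpecial .z) <| seq countUsed <|
  seq (atom (.push .K₁ (fun _ => ()) <| .push .K₂ (fun _ => ()) .halt)) <|
  seq writeN <| seq writeK <| seq writeMatrix <| seq dropB <| (atom (.load (fun _ => {}) .halt))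

/-! ### Correctness and time of the whole reduction. -/

theorem runs_countUsed (l : List Cell) (r : Reg) (m : Mem) :
    Runs countUsed (r, { m with V := l }.stk)
      ({ r with c := none }, { m with
        V := []
        K₁ := List.replicate (l.countP Cell.used) () ++ m.K₁
        K₂ := List.replicate (l.countP Cell.used) () ++ m.K₂ }.stk)
      (3 * l.length + 1) := by
  induction l generalizing r m with
  | nil => exact Runs.loop_exit (by simp [exec]) rfl
  | cons a l ih =>
    by_cases ha : a.used = true
    · refine (Runs.loop_step (s' := ({ r with c := some a }, { m with V := l }.stk)) ?_ rfl
        (Runs.ite_true ha (runs_atom' ?_))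
        (ih { r with c := some a } { m with K₁ := () :: m.K₁, K₂ := () :: m.K₂ })).cast ?_ ?_
      · simp [exec]
      · simp [exec]
      · simp [ha, List.replicate_succ']
      · simp; omega
    · refine (Runs.loop_step (s' := ({ r with c := some a }, { m with V := l }.stk)) ?_ rfl
        (Runs.ite_false (by simpa using ha) (runs_atom' ?_))
        (ih { r with c := some a } m)).cast ?_ ?_
      · simp [exec]
      · rfl
      · simp [ha]
      · simp; omega

theorem runs_writeN (k : ℕ) (r : Reg) (m : Mem) :
    Runs writeN (r, { m with N := List.replicate k () }.stk)
      ({ r with u := none }, { m with N := [], O := (encUnary k).reverse ++ m.O }.stk)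
      (2 * k + 2) := by
  have key : ∀ (r : Reg) (m : Mem), Runs
      (loop (.pop .N (fun r o => { r with u := o }) .halt) (fun r => r.u.isSome)
        (atom (.push .O (fun _ => some true) .halt)))
      (r, { m with N := List.replicate k () }.stk)
      ({ r with u := none }, { m with N := [], O := List.replicate k (some true) ++ m.O }.stk)
      (2 * k + 1) := by
    induction k with
    | zero => exact fun r m => Runs.loop_exit (by simp [exec]) rfl
    | succ k ih =>
      intro r m
      refine (Runs.loop_step (s' := ({ r with u := some () },
        { m with N := List.replicate k () }.stk)) ?_ rfl (runs_atom' ?_)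
        (ih { r with u := some () } { m with O := some true :: m.O })).cast ?_ ?_
      · simp [exec, List.replicate_succ]
      · simp [exec]
      · simp [List.replicate_succ']
      · omega
  exact ((key r m).seq (runs_atom' rfl)).cast (by simp [exec, encUnary]) (by omega)

theorem runs_writeK (k : ℕ) (r : Reg) (m : Mem) :
    Runs writeK (r, { m with K₁ := List.replicate k () }.stk)
      ({ r with u := none }, { m with K₁ := [], O := (encUnary k).reverse ++ m.O }.stk)
      (2 * k + 2) := by
  have key : ∀ (r : Reg) (m : Mem), Runs
      (loop (.pop .K₁ (fun r o => { r with u := o }) .halt) (fun r => r.u.isSome)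
        (atom (.push .O (fun _ => some true) .halt)))
      (r, { m with K₁ := List.replicate k () }.stk)
      ({ r with u := none }, { m with K₁ := [], O := List.replicate k (some true) ++ m.O }.stk)
      (2 * k + 1) := by
    induction k with
    | zero => exact fun r m => Runs.loop_exit (by simp [exec]) rfl
    | succ k ih =>
      intro r m
      refine (Runs.loop_step (s' := ({ r with u := some () },
        { m with K₁ := List.replicate k () }.stk)) ?_ rfl (runs_atom' ?_)
        (ih { r with u := some () } { m with O := some true :: m.O })).cast ?_ ?_
      · simp [exec, List.replicate_succ]
      · simp [exec]
      · simp [List.replicate_succ']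
      · omega
  exact ((key r m).seq (runs_atom' rfl)).cast (by simp [exec, encUnary]) (by omega)

theorem runs_dropB (l : List RSym) (r : Reg) (m : Mem) :
    Runs dropB (r, { m with B := l }.stk) ({ r with y := none }, { m with B := [] }.stk)
      (2 * l.length + 1) := by
  induction l generalizing r with
  | nil => exact Runs.loop_exit (by simp [exec]) rfl
  | cons a l ih =>
    refine (Runs.loop_step (s' := ({ r with y := some a }, { m with B := l }.stk)) ?_ rfl
      (runs_atom' ?_) (ih { r with y := some a })).cast ?_ ?_
    · simp [exec]
    · rfl
    · simp
    · simp; omega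

variable {q : ℕ} (φ : QCNF q)

/-- The parts of the text of a formula. -/
def tokens : List (Token φ.numVars) := φ.clauses.flatMap fun c => c.map some ++ [none]

/-- The result of reading a formula. -/
def readResult : ReadState φ.numVars := (tokens φ).foldl ReadState.next ([], [], [])

/-- The points of the instance built from a formula. -/
def labels : List (Label φ.numVars) := .z :: .w :: .w' :: (readResult φ).2.2

/-- The number of variables that occur. -/
def numUsed : ℕ := ((List.finRange φ.numVars).map (readResult φ).cell).countP Cell.used

/-- The text of the instance built from a formula. -/
def instWord : List (Option Bool) :=
  encUnary (labels φ).length ++ encUnary (numUsed φ + 1) ++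
    matrixWord [] ((labels φ).map Label.pt)

theorem encode_eq_tokens : φ.encode = encUnary φ.numVars ++ (tokens φ).flatMap Token.encode := by
  rw [QCNF.encode, tokens]
  congr 1
  induction φ.clauses with
  | nil => rfl
  | cons c cs ih =>
    rw [List.flatMap_cons, List.flatMap_cons, ih, List.flatMap_append]
    simp [Token.encode, List.flatMap_map]

theorem numUsed_le : numUsed φ ≤ φ.numVars := by
  refine List.countP_le_length.trans ?_
  simp

/-- The time of the reduction. -/
def reduceTime (n N t : ℕ) : ℕ :=
  (16 * n + 15) * t + N * (N * (6 * n + 9) + 2 * n + 4) + 2 * (N * (n + 1)) + 2 * N + 19 * n + 30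

/-- Besides the reversed text of the instance, a second copy of the number of centers survives on
`K₂`: it later tells how many numbers of the answer are centers. All other stacks and the registers
are reset. -/
theorem runs_reduce :
    Runs reduce ({}, { inp := φ.encode : Mem }.stk)
      ({}, { O := (instWord φ).reverse, K₂ := List.replicate (numUsed φ + 1) () : Mem }.stk)
      (reduceTime φ.numVars (labels φ).length (tokens φ).length) := by
  set s := readResult φ with hs
  have h1 := runs_readVars φ.numVars ((tokens φ).flatMap Token.encode) {} {}
  obtain ⟨r₂, h2⟩ := runs_readClauses (tokens φ) ([], [], []) { i := some none }
  have h3 := runs_emit_label (n := φ.numVars) .w' (fun _ => (false, false)) id s.cell s.2.2 r₂ {}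
    (fun _ => rfl) rfl
  have h4 := runs_emit_label (n := φ.numVars) .w (fun _ => (false, false)) id s.cell (.w' :: s.2.2)
    { r₂ with c := none } {} (fun _ => rfl) rfl
  have h5 := runs_emit_label (n := φ.numVars) .z (fun _ => (false, false)) id s.cell (.w :: .w' :: s.2.2)
    { r₂ with c := none } {} (fun _ => rfl) rfl
  have h6 := runs_countUsed ((List.finRange φ.numVars).map s.cell) { r₂ with c := none }
    { A := recs (labels φ), B := recs (labels φ), N := List.replicate (labels φ).length () }
  have h8 := runs_writeN (labels φ).length { r₂ with c := none }
    { A := recs (labels φ), B := recs (labels φ)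
      K₁ := List.replicate (numUsed φ + 1) (), K₂ := List.replicate (numUsed φ + 1) () }
  have h9 := runs_writeK (numUsed φ + 1) { r₂ with c := none, u := none }
    { A := recs (labels φ), B := recs (labels φ)
      K₂ := List.replicate (numUsed φ + 1) (), O := (encUnary (labels φ).length).reverse }
  obtain ⟨r₃, h10⟩ := runs_writeMatrix φ.numVars (labels φ).length [] ((labels φ).map Label.pt) (by simp)
    (by simp) { r₂ with c := none, u := none }
    { K₂ := List.replicate (numUsed φ + 1) ()
      O := (encUnary (labels φ).length ++ encUnary (numUsed φ + 1)).reverse } rfl rfl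
  have h11 := runs_dropB (mrecs (((labels φ).map Label.pt).map (true, ·))) r₃
    { K₂ := List.replicate (numUsed φ + 1) (), O := (instWord φ).reverse }
  rw [encode_eq_tokens]
  refine (h1.seq' ?_ (h2.seq' rfl (h3.seq' ?_ (h4.seq' ?_ (h5.seq' ?_ (h6.seq'
    rfl ((runs_atom' rfl).seq' ?_ (h8.seq' ?_ (h9.seq' ?_ (h10.seq' ?_ (h11.seq' rfl
      (runs_atom' rfl)))))))))))).cast ?_ ?_
  · have e : ReadState.cell (([], [], []) : ReadState φ.numVars) = fun _ => default := by
      funext j; simp [ReadState.cell]; rfl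
    simp [ReadState.mem, recs, e]
  · simp
  · simp
  · simp [labels, ← hs]
  · simp [exec, numUsed, List.replicate_succ]
    rfl
  · simp
  · simp [mrecs, recs, List.flatMap_map]
  · simp [instWord]
  · simp [exec]
  · rw [length_mrecs φ.numVars _ (by simp)]
    have := numUsed_le φ
    simp only [reduceTime, List.length_map, List.length_finRange]
    linarith

/-! ### Reading the answer off the clustering -/

/-- Move `O` to `inp`. -/
def pourO : Prog Alph Reg :=
  loop (.pop .O (fun r o => { r with i := o }) .halt) (fun r => r.i.isSome)
    (atom (.push .inp (fun r => r.i.getD none) .halt))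

/-- Read as many numbers as there are centers; remember whether one of them was zero. -/
def readCenters : Prog Alph Reg :=
  loop (.pop .K₂ (fun r o => { r with u := o }) .halt) (fun r => r.u.isSome)
    (seq (atom (.peek .inp (fun r o => { r with flag := r.flag || o == some none }) .halt))
      (loop (.pop .inp (fun r o => { r with i := o }) .halt) (fun r => r.i == some (some true))
        (atom .halt)))

/-- Empty the stack `inp`. -/
def dropInp : Prog Alph Reg :=
  loop (.pop .inp (fun r o => { r with i := o }) .halt) (fun r => r.i.isSome) (atom .halt)

/-- Read a clustering on the stack `O`, and answer whether the point `0` is not a center. -/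
def answer : Prog Alph Reg :=
  seq pourO <| seq readCenters <| seq dropInp <|
    atom (.push .O (fun r => some (!r.flag)) <| .load (fun _ => {}) .halt)

theorem runs_pourO (l : List (Option Bool)) (r : Reg) (m : Mem) :
    Runs pourO (r, { m with O := l }.stk)
      ({ r with i := none }, { m with O := [], inp := l.reverse ++ m.inp }.stk)
      (2 * l.length + 1) := by
  induction l generalizing r m with
  | nil => exact Runs.loop_exit (by simp [exec]) rfl
  | cons a l ih =>
    refine (Runs.loop_step (s' := ({ r with i := some a }, { m with O := l }.stk)) ?_ rfl
      (runs_atom' ?_) (ih { r with i := some a } { m with inp := a :: m.inp })).cast ?_ ?_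
    · simp [exec]
    · simp [exec]
    · simp
    · simp; omega

theorem runs_dropInp (l : List (Option Bool)) (r : Reg) (m : Mem) :
    Runs dropInp (r, { m with inp := l }.stk) ({ r with i := none }, { m with inp := [] }.stk)
      (2 * l.length + 1) := by
  induction l generalizing r with
  | nil => exact Runs.loop_exit (by simp [exec]) rfl
  | cons a l ih =>
    refine (Runs.loop_step (s' := ({ r with i := some a }, { m with inp := l }.stk)) ?_ rfl
      (runs_atom' ?_) (ih { r with i := some a })).cast ?_ ?_
    · simp [exec]
    · rfl
    · simp
    · simp; omega

theorem runs_skipUnary (a : ℕ) (rest : List (Option Bool)) (r : Reg) (m : Mem) :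
    Runs (loop (.pop .inp (fun r o => { r with i := o }) .halt)
        (fun r => r.i == some (some true)) (atom .halt))
      (r, { m with inp := encUnary a ++ rest }.stk)
      ({ r with i := some none }, { m with inp := rest }.stk) (2 * a + 1) := by
  induction a generalizing r with
  | zero => exact Runs.loop_exit (by simp [exec, encUnary]) rfl
  | succ a ih =>
    refine (Runs.loop_step
      (s' := ({ r with i := some (some true) }, { m with inp := encUnary a ++ rest }.stk)) ?_ rfl
      (runs_atom' ?_) (ih { r with i := some (some true) })).cast ?_ ?_
    · simp [exec, encUnary, List.replicate_succ]
    · rfl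
    · simp
    · omega

/-- A number in unary is zero exactly if its code starts with the separator, so one peek per center
decides whether the point 0 is among them. -/
theorem runs_readCenters (N : ℕ) (l : List ℕ) (hl : ∀ a ∈ l, a ≤ N) (rest : List (Option Bool))
    (r : Reg) (m : Mem) :
    ∃ r', r'.flag = (r.flag || l.any (· == 0)) ∧ Runs readCenters
      (r, { m with inp := l.flatMap encUnary ++ rest, K₂ := List.replicate l.length () }.stk)
      (r', { m with inp := rest, K₂ := [] }.stk) (l.length * (2 * N + 3) + 1) := by
  induction l generalizing r with
  | nil => exact ⟨{ r with u := none }, by simp,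
      Runs.mono (Runs.loop_exit (by simp [exec]) rfl) (by simp)⟩
  | cons a l ih =>
    obtain ⟨r', hr', h⟩ := ih (fun x hx => hl x (List.mem_cons_of_mem _ hx))
      { r with u := some (), flag := r.flag || a == 0, i := some none }
    have ha := hl a (by simp)
    refine ⟨r', ?_, (Runs.loop_step (s' := ({ r with u := some () }, { m with
        inp := encUnary a ++ (l.flatMap encUnary ++ rest)
        K₂ := List.replicate l.length () }.stk)) ?_ rfl
      ((runs_atom' (s' := ({ r with u := some (), flag := r.flag || a == 0 }, { m with
        inp := encUnary a ++ (l.flatMap encUnary ++ rest)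
        K₂ := List.replicate l.length () }.stk)) ?_).seq' rfl
        (runs_skipUnary a (l.flatMap encUnary ++ rest)
        { r with u := some (), flag := r.flag || a == 0 }
        { m with K₂ := List.replicate l.length () })) h).cast rfl ?_⟩
    · simp [hr', Bool.or_assoc]
    · simp [exec, List.replicate_succ]
    · cases a <;> simp [exec, encUnary, List.replicate_succ]
    · rw [List.length_cons, add_mul]; omega

theorem runs_answer (N : ℕ) (l : List ℕ) (hl : ∀ a ∈ l, a ≤ N) (rest : List (Option Bool)) :
    Runs answer
      ({}, { O := (l.flatMap encUnary ++ rest).reverse, K₂ := List.replicate l.length () : Mem }.stk)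
      ({}, { O := [some !(l.any (· == 0))] : Mem }.stk)
      (2 * (l.flatMap encUnary ++ rest).length + 2 * rest.length + l.length * (2 * N + 3) + 4) := by
  have h1 := runs_pourO (l.flatMap encUnary ++ rest).reverse {}
    { K₂ := List.replicate l.length () }
  obtain ⟨r', hr', h2⟩ := runs_readCenters N l hl rest {} {}
  have h3 := runs_dropInp rest r' {}
  refine (h1.seq' ?_ (h2.seq' rfl (h3.seq' rfl (runs_atom' rfl)))).cast ?_ ?_
  · simp
  · simp [exec, hr']
  · simp only [List.length_reverse]; omega

end SatToMedian

/-! ### The machine deciding satisfiability -/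

namespace SatToMedian

open Turing StackProgram

variable (M : TM2ComputableAux (Option Bool) (Option Bool))

/-- Move `O` to the input stack of `M`. -/
def feed : Prog (Side Alph M.tm.Γ) (Reg × M.tm.σ) :=
  loop (.pop (.inl .O) (fun v o => ({ v.1 with i := o }, v.2)) .halt) (fun v => v.1.i.isSome)
    (atom (.push (.inr M.tm.k₀) (fun v => M.inputAlphabet.symm (v.1.i.getD none)) .halt))

/-- Move the output stack of `M` to `O`. -/
def fetch : Prog (Side Alph M.tm.Γ) (Reg × M.tm.σ) :=
  loop (.pop (.inr M.tm.k₁) (fun v o => ({ v.1 with i := o.map M.outputAlphabet }, v.2)) .halt)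
    (fun v => v.1.i.isSome)
    (atom (.push (.inl .O) (fun v => v.1.i.getD none) .halt))

/-- The machine `M` as a program. -/
def black : Prog M.tm.Γ M.tm.σ where
  Λ := M.tm.Λ
  fin := M.tm.ΛFin
  main := M.tm.main
  m := M.tm.m

/-- Reduce, run `M`, and read off the answer. -/
def decider : Prog (Side Alph M.tm.Γ) (Reg × M.tm.σ) :=
  seq reduce.left <| seq (feed M) <| seq (black M).right <| seq (fetch M) answer.left

/-- The machine deciding satisfiability. -/
noncomputable def deciderTM : FinTM2 where
  K := Stk ⊕ M.tm.K
  kDecidableEq := inferInstance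
  kFin := haveI := M.tm.kFin; inferInstance
  k₀ := .inl .inp
  k₁ := .inl .O
  Γ := Side Alph M.tm.Γ
  Λ := (decider M).Λ
  main := (decider M).main
  ΛFin := (decider M).fin
  σ := Reg × M.tm.σ
  initialState := ({}, M.tm.initialState)
  σFin := haveI := M.tm.σFin; inferInstance
  Γk₀Fin := inferInstanceAs (Fintype (Option Bool))
  m := (decider M).m

/-- The machine deciding satisfiability, with its alphabets. -/
noncomputable def deciderAux : TM2ComputableAux (Option Bool) (Option Bool) where
  tm := deciderTM M
  inputAlphabet := Equiv.refl _
  outputAlphabet := Equiv.refl _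

/-- Stacks all of which but one are empty. -/
def single {K : Type} [DecidableEq K] {Γ : K → Type} (k : K) (l : List (Γ k)) (j : K) :
    List (Γ j) := Function.update (fun _ => []) k l j

theorem update_single {K : Type} [DecidableEq K] {Γ : K → Type} (k : K) (l l' : List (Γ k)) :
    Function.update (single (Γ := Γ) k l) k l' = single k l' :=
  Function.update_idem ..

theorem single_self {K : Type} [DecidableEq K] {Γ : K → Type} (k : K) (l : List (Γ k)) :
    single (Γ := Γ) k l k = l := Function.update_self ..

theorem single_nil {K : Type} [DecidableEq K] {Γ : K → Type} (k k' : K) :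
    single (Γ := Γ) k [] = single k' [] :=
  (Function.update_eq_self k (fun j : K => ([] : List (Γ j)))).trans
    (Function.update_eq_self k' (fun j : K => ([] : List (Γ j)))).symm

/-- Pouring a stack reverses it. The instance lies reversed on `O`, so it arrives on the input stack
in reading order. -/
theorem runs_feed (l : List (Option Bool)) (l' : List (M.tm.Γ M.tm.k₀)) (r : Reg) (v : M.tm.σ)
    (m : Mem) :
    Runs (feed M) ((r, v), join { m with O := l }.stk (single M.tm.k₀ l'))
      (({ r with i := none }, v), join { m with O := [] }.stk
        (single M.tm.k₀ (l.reverse.map M.inputAlphabet.symm ++ l'))) (2 * l.length + 1) := by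
  have pop : ∀ (r : Reg) (l : List (Option Bool)) (S : ∀ k, List (M.tm.Γ k)),
      exec (.pop (.inl .O) (fun v o => ({ v.1 with i := o }, v.2)) .halt)
        ((r, v), join { m with O := l }.stk S) =
      (({ r with i := l.head? }, v), join { m with O := l.tail }.stk S) := fun r l S =>
    congrArg (Prod.mk _) ((update_join_inl ..).trans
      (congrArg (fun T => join T S) (Mem.update_O ..)))
  have push : ∀ (r : Reg) (l : List (M.tm.Γ M.tm.k₀)) (S : ∀ k, List (Alph k)),
      exec (.push (.inr M.tm.k₀) (fun v => M.inputAlphabet.symm (v.1.i.getD none)) .halt)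
        ((r, v), join S (single M.tm.k₀ l)) =
      ((r, v), join S (single M.tm.k₀ (M.inputAlphabet.symm (r.i.getD none) :: l))) := by
    intro r l S
    have h : join S (single (Γ := M.tm.Γ) M.tm.k₀ l) (.inr M.tm.k₀) = l := single_self ..
    simp only [exec, TM2.stepAux]
    rw [h]
    exact congrArg (Prod.mk _) ((update_join_inr ..).trans (congrArg (join S) (update_single ..)))
  induction l generalizing r l' with
  | nil => exact Runs.loop_exit (pop r [] _) rfl
  | cons a l ih =>
    refine (Runs.loop_step (pop r (a :: l) (single M.tm.k₀ l')) rfl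
      (runs_atom' (push { r with i := some a } l' { m with O := l }.stk))
      (ih (M.inputAlphabet.symm a :: l') { r with i := some a })).cast ?_ ?_
    · simp
    · simp; omega

theorem runs_fetch (l : List (M.tm.Γ M.tm.k₁)) (l' : List (Option Bool)) (r : Reg) (v : M.tm.σ)
    (m : Mem) :
    Runs (fetch M) ((r, v), join { m with O := l' }.stk (single M.tm.k₁ l))
      (({ r with i := none }, v), join { m with O := l.reverse.map M.outputAlphabet ++ l' }.stk
        (single M.tm.k₁ [])) (2 * l.length + 1) := by
  have pop : ∀ (r : Reg) (l : List (M.tm.Γ M.tm.k₁)) (S : ∀ k, List (Alph k)),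
      exec (.pop (.inr M.tm.k₁) (fun v o => ({ v.1 with i := o.map M.outputAlphabet }, v.2)) .halt)
        ((r, v), join S (single M.tm.k₁ l)) =
      (({ r with i := l.head?.map M.outputAlphabet }, v), join S (single M.tm.k₁ l.tail)) := by
    intro r l S
    have h : join S (single (Γ := M.tm.Γ) M.tm.k₁ l) (.inr M.tm.k₁) = l := single_self ..
    simp only [exec, TM2.stepAux]
    rw [h]
    exact congrArg (Prod.mk _) ((update_join_inr ..).trans (congrArg (join S) (update_single ..)))
  have push : ∀ (r : Reg) (l : List (Option Bool)) (S : ∀ k, List (M.tm.Γ k)),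
      exec (.push (.inl .O) (fun v => v.1.i.getD none) .halt)
        ((r, v), join { m with O := l }.stk S) =
      ((r, v), join { m with O := r.i.getD none :: l }.stk S) := fun r l S =>
    congrArg (Prod.mk _) ((update_join_inl ..).trans
      (congrArg (fun T => join T S) (Mem.update_O ..)))
  induction l generalizing r l' with
  | nil => exact Runs.loop_exit (pop r [] _) rfl
  | cons a l ih =>
    refine (Runs.loop_step (pop r (a :: l) { m with O := l' }.stk) rfl
      (runs_atom' (push { r with i := some (M.outputAlphabet a) } l' (single M.tm.k₁ l)))
      (ih (M.outputAlphabet a :: l') { r with i := some (M.outputAlphabet a) })).cast ?_ ?_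
    · simp
    · simp; omega

theorem initList_eq (tm : FinTM2) (l : List (tm.Γ tm.k₀)) :
    initList tm l = ⟨some tm.main, tm.initialState, single tm.k₀ l⟩ := by
  refine congrArg (TM2.Cfg.mk _ _) ?_
  funext j
  by_cases h : j = tm.k₀
  · subst h
    simp [single]
  · simp [single, h]

theorem haltList_eq (tm : FinTM2) (l : List (tm.Γ tm.k₁)) :
    haltList tm l = ⟨none, tm.initialState, single tm.k₁ l⟩ := by
  refine congrArg (TM2.Cfg.mk _ _) ?_
  funext j
  by_cases h : j = tm.k₁
  · subst h
    simp [single]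
  · simp [single, h]

variable {M} in
-- A halting run of `M` leaves its initial registers and only the output on its stacks, so the state
-- afterwards is fully known.
theorem runs_black {l : List (M.tm.Γ M.tm.k₀)} {l' : List (M.tm.Γ M.tm.k₁)} {t : ℕ}
    (h : TM2OutputsInTime M.tm l (some l') t) :
    Runs (black M) (M.tm.initialState, single M.tm.k₀ l) (M.tm.initialState, single M.tm.k₁ l')
      t := by
  obtain ⟨⟨n, h⟩, hn⟩ := h
  refine ⟨n, hn, reachesIn_iff_iterate.2 ?_⟩
  simp only [initList_eq, Option.map_some, haltList_eq] at h
  exact h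

/-- An output counts only if all other stacks are empty and the registers have their initial values;
this is why the programs clean up after themselves. -/
theorem outputs_of_runs {l w : List (Option Bool)} {t : ℕ}
    (h : Runs (decider M) (({}, M.tm.initialState), join { inp := l : Mem }.stk (single M.tm.k₀ []))
      (({}, M.tm.initialState), join { O := w : Mem }.stk (single M.tm.k₀ [])) t) :
    Nonempty (TM2OutputsInTime (deciderAux M).tm (l.map (deciderAux M).inputAlphabet.symm)
      (some (w.map (deciderAux M).outputAlphabet.symm)) t) := by
  obtain ⟨n, hn, h⟩ := h
  rw [reachesIn_iff_iterate] at h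
  have hi : initList (deciderAux M).tm (l.map (deciderAux M).inputAlphabet.symm) =
      ⟨some (decider M).main, ({}, M.tm.initialState),
        join { inp := l : Mem }.stk (single M.tm.k₀ [])⟩ := by
    refine (initList_eq ..).trans (congrArg (TM2.Cfg.mk _ _) ?_)
    funext j
    rcases j with j | j
    · cases j
      · exact (single_self ..).trans (List.map_id l)
      all_goals exact Function.update_of_ne (by simp [deciderAux, deciderTM]) ..
    · exact (Function.update_of_ne (by simp [deciderAux, deciderTM]) ..).trans
        (congrFun (Function.update_eq_self M.tm.k₀ fun j => ([] : List (M.tm.Γ j))) j).symm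
  have ho : haltList (deciderAux M).tm (w.map (deciderAux M).outputAlphabet.symm) =
      ⟨none, ({}, M.tm.initialState),
        join { O := w : Mem }.stk (single M.tm.k₀ [])⟩ := by
    refine (haltList_eq ..).trans (congrArg (TM2.Cfg.mk _ _) ?_)
    funext j
    rcases j with j | j
    · cases j
      case O => exact (single_self ..).trans (List.map_id w)
      all_goals exact Function.update_of_ne (by simp [deciderAux, deciderTM]) ..
    · exact (Function.update_of_ne (by simp [deciderAux, deciderTM]) ..).trans
        (congrFun (Function.update_eq_self M.tm.k₀ fun j => ([] : List (M.tm.Γ j))) j).symm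
  refine ⟨⟨⟨n, ?_⟩, hn⟩⟩
  rw [hi, Option.map_some, ho]
  exact h

variable {q : ℕ} (φ : QCNF q)

theorem runs_decider {l : List ℕ} {rest : List (Option Bool)} {N t : ℕ}
    (hl : l.length = numUsed φ + 1) (hN : ∀ a ∈ l, a ≤ N)
    (h : TM2OutputsInTime M.tm ((instWord φ).map M.inputAlphabet.symm)
      (some ((l.flatMap encUnary ++ rest).map M.outputAlphabet.symm)) t) :
    Runs (decider M)
      (({}, M.tm.initialState), join { inp := φ.encode : Mem }.stk (single M.tm.k₀ []))
      (({}, M.tm.initialState), join { O := [some !(l.any (· == 0))] : Mem }.stk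
        (single M.tm.k₀ []))
      (reduceTime φ.numVars (labels φ).length (tokens φ).length + 2 * (instWord φ).length + t +
        4 * (l.flatMap encUnary ++ rest).length + 2 * rest.length + l.length * (2 * N + 3) + 6) := by
  have h1 := (runs_reduce φ).left (Γ' := M.tm.Γ) (σ' := M.tm.σ) M.tm.initialState
    (single (Γ := M.tm.Γ) M.tm.k₀ [])
  have h2 := runs_feed M (instWord φ).reverse [] {} M.tm.initialState
    { K₂ := List.replicate (numUsed φ + 1) () }
  have h3 := (runs_black h).right (σ := Reg) (Γ := Alph) {}
    (Mem.stk { K₂ := List.replicate (numUsed φ + 1) () })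
  have h4 := runs_fetch M ((l.flatMap encUnary ++ rest).map M.outputAlphabet.symm) [] {}
    M.tm.initialState { K₂ := List.replicate (numUsed φ + 1) () }
  have h5 := (runs_answer N l hN rest).left (Γ' := M.tm.Γ) (σ' := M.tm.σ) M.tm.initialState
    (single (Γ := M.tm.Γ) M.tm.k₁ [])
  refine (h1.seq' rfl (h2.seq' ?_ (h3.seq' rfl (h4.seq' ?_ h5)))).cast ?_ ?_
  · simp
  · simp [hl, ← List.map_reverse]
  · rw [single_nil]
  · simp only [List.length_reverse, List.length_map]; omega

end SatToMedian

/-! ### The instance built from a formula -/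

namespace SatToMedian

variable {q : ℕ} (φ : QCNF q)

/-- The points written for a clause. -/
def clauseLabels {n : ℕ} (c : List (Fin n × Bool)) : List (Label n) :=
  .cl c.reverse :: c.reverse.flatMap fun l => [.tt l.1, .lit l.1 false, .lit l.1 true]

theorem foldl_next_clause {n : ℕ} (c cur seen : List (Fin n × Bool)) (ls : List (Label n)) :
    (c.map some).foldl ReadState.next (cur, seen, ls) =
      (c.reverse ++ cur, c.reverse ++ seen,
        (c.reverse.flatMap fun l => [.tt l.1, .lit l.1 false, .lit l.1 true]) ++ ls) := by
  induction c generalizing cur seen ls with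
  | nil => rfl
  | cons l c ih => simp [ReadState.next, ih]

/-- Clauses and literals come out in reverse, since everything is pushed; the order is irrelevant
for the distances. -/
theorem readResult_eq :
    readResult φ = ([], φ.clauses.reverse.flatMap List.reverse,
      φ.clauses.reverse.flatMap clauseLabels) := by
  have key : ∀ (cs : List (List (Fin φ.numVars × Bool))) (seen) (ls : List (Label φ.numVars)),
      (cs.flatMap fun c => c.map some ++ [none]).foldl ReadState.next ([], seen, ls) =
        ([], cs.reverse.flatMap List.reverse ++ seen, cs.reverse.flatMap clauseLabels ++ ls) := by
    intro cs
    induction cs with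
    | nil => intro _ _; rfl
    | cons c cs ih =>
      intro seen ls
      rw [List.flatMap_cons, List.foldl_append, List.foldl_append, foldl_next_clause]
      simp [ReadState.next, ih, clauseLabels]
  simpa [readResult, tokens] using key φ.clauses [] []

/-- The variables that occur. -/
def usedVars : Finset (Fin φ.numVars) :=
  Finset.univ.filter fun v => ∃ c ∈ φ.clauses, ∃ b, (v, b) ∈ c

variable {φ} in
theorem mem_usedVars {v : Fin φ.numVars} :
    v ∈ usedVars φ ↔ ∃ c ∈ φ.clauses, ∃ b, (v, b) ∈ c := by simp [usedVars]

theorem numUsed_eq_card : numUsed φ = (usedVars φ).card := by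
  rw [numUsed, List.countP_map, List.countP_eq_length_filter,
    ← List.toFinset_card_of_nodup ((List.nodup_finRange _).filter _)]
  congr 1
  ext v
  simp only [List.toFinset_filter, List.toFinset_finRange, Finset.mem_filter, Finset.mem_univ,
    true_and, mem_usedVars, Function.comp, ReadState.cell, readResult_eq, decide_eq_true_eq]
  simp only [List.mem_flatMap, List.mem_reverse, Bool.exists_bool]
  grind

variable {φ} in
theorem mem_labels {a : Label φ.numVars} :
    a ∈ labels φ ↔ a = .z ∨ a = .w ∨ a = .w' ∨ (∃ c ∈ φ.clauses, a = .cl c.reverse) ∨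
      ∃ v ∈ usedVars φ, a = .tt v ∨ a = .lit v false ∨ a = .lit v true := by
  simp only [labels, readResult_eq, List.mem_cons, List.mem_flatMap, List.mem_reverse,
    clauseLabels, List.not_mem_nil, or_false, mem_usedVars]
  grind

/-- Points are written per occurrence, not per variable. Repetitions do no harm, and the count
depends on the clauses only, not on variables that never occur. -/
theorem length_labels :
    (labels φ).length = 3 + (φ.clauses.map fun c => 3 * c.length + 1).sum := by
  simp only [labels, readResult_eq, List.length_cons, List.length_flatMap, List.map_reverse,
    List.sum_reverse, clauseLabels, List.map_const', List.sum_replicate, List.length_nil]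
  have : (fun c : List (Fin φ.numVars × Bool) => c.length • (0 + 1 + 1 + 1) + 1) =
      fun c => 3 * c.length + 1 := by funext c; simp [mul_comm]
  rw [this]; omega

/-- The answer is read from the index 0, so z must be found there and nowhere else. -/
theorem labels_eq_z {i : Fin (labels φ).length} (h : (labels φ).get i = .z) : (i : ℕ) = 0 := by
  obtain ⟨_ | _ | _ | i, hi⟩ := i
  · rfl
  · cases h
  · cases h
  · have : (Label.z : Label φ.numVars) ∈ (readResult φ).2.2 := h ▸ List.get_mem ..
    simp [readResult_eq, clauseLabels] at this

theorem labels_eq_w' {i : Fin (labels φ).length} (h : (labels φ).get i = .w') : (i : ℕ) = 2 := by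
  obtain ⟨_ | _ | _ | i, hi⟩ := i
  · cases h
  · cases h
  · rfl
  · have : (Label.w' : Label φ.numVars) ∈ (readResult φ).2.2 := h ▸ List.get_mem ..
    simp [readResult_eq, clauseLabels] at this

/-- The distance of two distinct points. -/
def Label.dist {n : ℕ} (a b : Label n) : ℕ := a.pt.dist b.pt

/-- Both rows list the variables in the same order, so the positionwise comparison is an existential
over variables. -/
theorem Label.dist_eq {n : ℕ} (a b : Label n) :
    a.dist b = kdist a.kind b.kind (decide (∃ j, meet (a.row j) (b.row j) = true)) := by
  rw [dist, Pt.dist]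
  congr 1
  rw [Bool.eq_iff_iff]
  simp [meetRows, pt, ← List.map_reverse, List.zip_map']

theorem kdist_mem (k k' : Kind) (b : Bool) : kdist k k' b ∈ ({4, 5, 6} : Finset ℕ) := by
  cases b <;> cases k <;> cases k' <;> decide

theorem kdist_comm (k k' : Kind) (b : Bool) : kdist k k' b = kdist k' k b := by
  cases b <;> cases k <;> cases k' <;> rfl

theorem Label.dist_mem {n : ℕ} (a b : Label n) : a.dist b ∈ ({4, 5, 6} : Finset ℕ) := by
  rw [dist_eq]
  exact kdist_mem ..

theorem Label.dist_comm {n : ℕ} (a b : Label n) : a.dist b = b.dist a := by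
  have : ∀ j, meet (a.row j) (b.row j) = meet (b.row j) (a.row j) := by simp [meet, Bool.and_comm]
  rw [dist_eq, dist_eq, kdist_comm]
  simp only [this]

theorem Label.four_le_dist {n : ℕ} (a b : Label n) : 4 ≤ a.dist b := by
  have := a.dist_mem b
  simp only [Finset.mem_insert, Finset.mem_singleton] at this
  omega

theorem Label.dist_le_six {n : ℕ} (a b : Label n) : a.dist b ≤ 6 := by
  have := a.dist_mem b
  simp only [Finset.mem_insert, Finset.mem_singleton] at this
  omega

variable {φ} in
theorem mem_labels_of_used {v : Fin φ.numVars} (hv : v ∈ usedVars φ) :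
    .tt v ∈ labels φ ∧ ∀ b, .lit v b ∈ labels φ := by
  refine ⟨mem_labels.2 (by simp [hv]), fun b => mem_labels.2 ?_⟩
  cases b <;> simp [hv]

/-- The point z and one `tt` point for each used variable are already distinct labels. -/
theorem numUsed_lt_length_labels : numUsed φ + 1 ≤ (labels φ).length := by
  classical
  rw [numUsed_eq_card]
  have h : (insert Label.z ((usedVars φ).image Label.tt)).card ≤ (labels φ).toFinset.card := by
    refine Finset.card_le_card fun a ha => List.mem_toFinset.2 ?_
    simp only [Finset.mem_insert, Finset.mem_image] at ha
    rcases ha with rfl | ⟨v, hv, rfl⟩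
    · simp [labels]
    · exact (mem_labels_of_used hv).1
  rw [Finset.card_insert_of_notMem (by simp), Finset.card_image_of_injective _
    (fun _ _ h => by simpa using h)] at h
  exact h.trans (List.toFinset_card_le _)

/-- The instance of `k`-Median built from a formula. -/
def medianInstance : KMedianInstance where
  n := (labels φ).length
  d x y := if x = y then 0 else (((labels φ).get x).dist ((labels φ).get y) : ℚ)
  d_self x := by simp
  d_pos x y h := by
    rw [if_neg h]
    exact_mod_cast (by norm_num : 0 < 4).trans_le (Label.four_le_dist ..)
  d_symm x y := by simp only [Label.dist_comm, eq_comm]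
  d_triangle x y z := by
    have h1 : ∀ a b : Label φ.numVars, (4 : ℚ) ≤ a.dist b := fun a b => by
      exact_mod_cast a.four_le_dist b
    have h2 : ∀ a b : Label φ.numVars, (a.dist b : ℚ) ≤ 6 := fun a b => by
      exact_mod_cast a.dist_le_six b
    have a1 := h1 ((labels φ).get x) ((labels φ).get y)
    have a2 := h1 ((labels φ).get y) ((labels φ).get z)
    have a3 := h2 ((labels φ).get x) ((labels φ).get z)
    by_cases hxy : x = y
    · simp [hxy]
    · by_cases hyz : y = z
      · simp [hyz]
      · rw [if_neg hxy, if_neg hyz]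
        -- Two distinct legs contribute at least 4 + 4, and no distance exceeds 6.
        split_ifs <;> linarith
  k := numUsed φ + 1
  one_le_k := by omega
  k_le_n := numUsed_lt_length_labels φ

/-- In binary with the lowest bit first, 4, 5, 6 are 001, 101, 011: the two leading bits test for 5
and for 6. Zero is the empty word, and the denominator is always 1. -/
theorem distWord_eq (d : ℕ) (h : d = 0 ∨ d ∈ ({4, 5, 6} : Finset ℕ)) :
    distWord d = encBinary (d : ℚ).num.natAbs ++ encBinary (d : ℚ).den := by
  rw [Rat.num_natCast, Rat.den_natCast, Int.natAbs_natCast]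
  simp only [Finset.mem_insert, Finset.mem_singleton] at h
  rcases h with rfl | rfl | rfl | rfl <;> decide

/-- A row of the matrix of distances. -/
def rowOf (P : List Pt) (x : Fin P.length) : List (Option Bool) :=
  (List.finRange P.length).flatMap fun y =>
    distWord (if x = y then 0 else (P.get x).dist (P.get y))

theorem rowWord_eq (p : Pt) (done l : List Pt) :
    rowWord p false (done.map (true, ·) ++ (p :: l).map (false, ·)) =
      done.flatMap (fun q => distWord (p.dist q)) ++
        (distWord 0 ++ l.flatMap fun q => distWord (p.dist q)) := by
  have h : ∀ l : List Pt, rowWord p true (l.map (false, ·)) =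
      l.flatMap fun q => distWord (p.dist q) := fun l => by
    induction l with
    | nil => rfl
    | cons a l ih => simp [rowWord, ih]
  induction done with
  | nil => simpa [rowWord] using h l
  | cons a done ih => simpa [rowWord] using ih

theorem rowOf_eq (P : List Pt) (x : Fin P.length) :
    rowOf P x = rowWord (P.get x) false
      ((P.take x).map (true, ·) ++ (P.get x :: P.drop (x + 1)).map (false, ·)) := by
  obtain ⟨l, l', h, hl, hx, hx'⟩ := finRange_eq_append_cons x
  have hP : P = l.map P.get ++ P.get x :: l'.map P.get := by
    rw [← List.map_cons, ← List.map_append, ← h, List.map_get_finRange]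
  have h1 : P.take x = l.map P.get := by
    exact (congrArg (List.take x) hP).trans (List.take_left' (by simp [hl]))
  have h2 : P.drop (x + 1) = l'.map P.get := by
    refine (congrArg (List.drop (x + 1)) hP).trans ?_
    rw [List.drop_append, List.drop_of_length_le (by simp [hl]), List.length_map, hl,
      Nat.add_sub_cancel_left]
    rfl
  rw [h1, h2, rowWord_eq, rowOf, h, List.flatMap_append, List.flatMap_cons, List.flatMap_map,
    List.flatMap_map, if_pos rfl]
  congr 1
  · refine List.flatMap_congr fun y hy => ?_
    rw [if_neg (by rintro rfl; exact hx hy)]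
  · congr 1
    refine List.flatMap_congr fun y hy => ?_
    rw [if_neg (by rintro rfl; exact hx' hy)]

theorem matrixWord_eq (P done l : List Pt) (h : P = done ++ l) :
    matrixWord done l = ((List.finRange P.length).drop done.length).flatMap (rowOf P) := by
  induction l generalizing done with
  | nil =>
    rw [List.drop_of_length_le (by simp [h])]
    rfl
  | cons p l ih =>
    have hlt : done.length < P.length := by simp [h]
    rw [matrixWord, ih (done ++ [p]) (by simp [h]),
      List.drop_eq_getElem_cons (i := done.length) (by simpa using hlt), List.flatMap_cons, rowOf_eq]
    have h1 : P.get ⟨done.length, hlt⟩ = p := by simp [h]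
    have h2 : P.take done.length = done := by simp [h]
    have h3 : P.drop (done.length + 1) = l := by simp [h]
    simp only [List.getElem_finRange, Fin.cast_mk, h1, h2, h3, List.length_append,
      List.length_singleton]

theorem instWord_eq_encode : instWord φ = (medianInstance φ).encode := by
  rw [instWord, KMedianInstance.encode, matrixWord_eq _ [] _ rfl]
  congr 1
  -- The length of the mapped list is generalized to `N`, so that the index types of the two
  -- matrices can be identified.
  have key : ∀ (N : ℕ) (hN : N = ((labels φ).map Label.pt).length),
      (List.finRange ((labels φ).map Label.pt).length).flatMap (rowOf ((labels φ).map Label.pt)) =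
      (List.finRange N).flatMap fun x => (List.finRange N).flatMap fun y =>
        distWord (if x = y then 0 else (((labels φ).map Label.pt).get (x.cast hN)).dist
          (((labels φ).map Label.pt).get (y.cast hN))) := by
    rintro N rfl
    rfl
  refine (key _ (List.length_map _).symm).trans ?_
  refine List.flatMap_congr fun x _ => List.flatMap_congr fun y _ => ?_
  simp only [medianInstance, List.get_eq_getElem, List.getElem_map, Fin.val_cast]
  split_ifs
  · exact distWord_eq 0 (.inl rfl)
  · exact distWord_eq _ (.inr (Label.dist_mem ..))

end SatToMedian

/-! ### Costs of clusterings -/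

namespace Clustering

variable {X : Type*} {k : ℕ}

theorem cost_eq_sum {R : Type*} [Fintype X] [AddCommMonoid R] (S : Clustering X k)
    (d : X → X → R) : S.cost d = ∑ x, d (S.center (S.cluster x)) x := by
  rw [cost, ← Finset.sum_fiberwise Finset.univ S.cluster]
  refine Finset.sum_congr rfl fun i _ => Finset.sum_congr rfl fun x hx => ?_
  rw [(Finset.mem_filter.1 hx).2]

/-- A center need not lie in its own cluster, so the points of cost zero need not be all the
centers. Such a point is determined by its cluster, which bounds their number. -/
theorem card_filter_le [Fintype X] [DecidableEq X] (S : Clustering X k) :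
    (Finset.univ.filter fun x => S.center (S.cluster x) = x).card ≤ k := by
  have h := Finset.card_le_card_of_injOn (t := Finset.univ) S.cluster (fun _ _ => by simp)
    (s := Finset.univ.filter fun x => S.center (S.cluster x) = x) (by
      intro x hx y hy hxy
      simp only [Finset.coe_filter, Finset.mem_univ, true_and, Set.mem_ofPred_eq] at hx hy
      rw [← hx, ← hy, hxy])
  simpa using h

/-- Sending every center to itself makes all clusters nonempty; `g` decides only about the remaining
points. -/
theorem exists_of_centers [DecidableEq X] (C : Finset X) (hC : C.card = k) (g : X → X)
    (hg : ∀ x, g x ∈ C) :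
    ∃ S : Clustering X k, ∀ x, S.center (S.cluster x) = if x ∈ C then x else g x := by
  let e := C.equivFinOfCardEq hC
  have hmem : ∀ x, (if x ∈ C then x else g x) ∈ C := fun x => by
    split_ifs with h
    exacts [h, hg x]
  refine ⟨⟨fun i => e.symm i, fun i j h => by simpa using h, fun x => e ⟨_, hmem x⟩, fun i => ?_⟩,
    fun x => by simp⟩
  refine ⟨e.symm i, ?_⟩
  simp

theorem sum_off_eq [Fintype X] [DecidableEq X] {R : Type*} [Semiring R] (C : Finset X) (a : R) :
    ∑ x, (if x ∈ C then 0 else a) = ((Fintype.card X - C.card : ℕ) : R) * a := by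
  rw [Finset.sum_ite, Finset.sum_const_zero, zero_add, Finset.sum_const, nsmul_eq_mul,
    Finset.filter_not, Finset.card_sdiff_of_subset (Finset.filter_subset _ _)]
  simp

/-- At most k points cost nothing and all others at least `a`, so the excesses over this baseline
are nonnegative with sum at most `e`; hence none of them exceeds `e`. -/
theorem dist_center_le [Fintype X] [DecidableEq X] (S : Clustering X k) (d : X → X → ℚ) {a e : ℚ}
    (ha : 0 ≤ a) (h0 : ∀ x, d x x = 0) (hd : ∀ x y, x ≠ y → a ≤ d x y)
    (h : S.cost d ≤ (Fintype.card X - k) * a + e) (x : X) :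
    d (S.center (S.cluster x)) x ≤ a + e := by
  set Z := Finset.univ.filter fun x => S.center (S.cluster x) = x with hZ
  have hZk : (Z.card : ℚ) ≤ k := by exact_mod_cast S.card_filter_le
  have hpos : ∀ y, 0 ≤ d (S.center (S.cluster y)) y - if y ∈ Z then 0 else a := by
    intro y
    split_ifs with hy
    · rw [(Finset.mem_filter.1 hy).2, h0, sub_zero]
    · exact sub_nonneg.2 (hd _ _ (by simpa [hZ] using hy))
  have h1 := Finset.single_le_sum (fun y _ => hpos y) (Finset.mem_univ x)
  rw [Finset.sum_sub_distrib, sum_off_eq, ← cost_eq_sum, Nat.cast_sub (Finset.card_le_univ _)] at h1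
  have h2 : (if x ∈ Z then 0 else a) ≤ a := by split_ifs <;> simp [ha]
  nlinarith

/-- The upper bound matching `dist_center_le`: every point outside `C` costs at most `a`, and the
surplus `e` is incurred at most once, at `z`. -/
theorem exists_cost_le [Fintype X] [DecidableEq X] (d : X → X → ℚ) {a e : ℚ} (he : 0 ≤ e)
    (h0 : ∀ x, d x x = 0) (C : Finset X) (hC : C.card = k) (z : X)
    (hd : ∀ x ∉ C, ∃ y ∈ C, d y x ≤ a + if x = z then e else 0) (hne : C.Nonempty) :
    ∃ S : Clustering X k, S.cost d ≤ (Fintype.card X - k) * a + e := by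
  have : ∀ x, ∃ y ∈ C, x ∉ C → d y x ≤ a + if x = z then e else 0 := by
    intro x
    by_cases hx : x ∈ C
    · exact ⟨hne.choose, hne.choose_spec, fun h => absurd hx h⟩
    · obtain ⟨y, hy, h⟩ := hd x hx
      exact ⟨y, hy, fun _ => h⟩
  choose g hg hgd using this
  obtain ⟨S, hS⟩ := exists_of_centers C hC g hg
  refine ⟨S, ?_⟩
  have : ∑ x, (if x ∈ C then 0 else a) + ∑ x, (if x = z then e else 0) =
      (Fintype.card X - k) * a + e := by
    rw [sum_off_eq, Nat.cast_sub (Finset.card_le_univ _), hC]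
    simp
  rw [cost_eq_sum, ← this, ← Finset.sum_add_distrib]
  refine Finset.sum_le_sum fun x _ => ?_
  rw [hS]
  split_ifs with h1 h2 h2
  · simp [h0, he]
  · simp [h0]
  · simpa [h2] using hgd x h1
  · simpa [h2] using hgd x h1

end Clustering

/-! ### Dominating sets -/

namespace SimpleGraph

variable {V : Type*} [DecidableEq V] (G : SimpleGraph V)

theorem IsDominatingSet.exists_clustering {G : SimpleGraph V} {k : ℕ} (hk : 1 ≤ k) {S : Finset V}
    (hS : S.card = k) (h : G.IsDominatingSet S) :
    ∃ P : Clustering V k, ∃ C : Finset V, C.card = k ∧ ∀ x,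
      if x ∈ C then P.center (P.cluster x) = x else G.Adj (P.center (P.cluster x)) x := by
  have hne : S.Nonempty := Finset.card_pos.1 (by omega)
  have : ∀ x, ∃ y ∈ S, x ∉ S → G.Adj y x := fun x => by
    rcases h x with hx | ⟨y, hy, hyx⟩
    · exact ⟨hne.choose, hne.choose_spec, fun h => absurd hx h⟩
    · exact ⟨y, hy, fun _ => hyx⟩
  choose g hg hgd using this
  obtain ⟨P, hP⟩ := Clustering.exists_of_centers S hS g hg
  refine ⟨P, S, hS, fun x => ?_⟩
  split_ifs with hx
  · rw [hP, if_pos hx]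
  · rw [hP, if_neg hx]
    exact hgd x hx

theorem exists_isDominatingSet_of_clustering {k : ℕ} (P : Clustering V k)
    (h : ∀ x, P.center (P.cluster x) = x ∨ G.Adj (P.center (P.cluster x)) x) :
    ∃ S : Finset V, S.card = k ∧ G.IsDominatingSet S := by
  refine ⟨Finset.univ.image P.center, ?_, fun x => ?_⟩
  · rw [Finset.card_image_of_injective _ P.center_injective, Finset.card_univ, Fintype.card_fin]
  · rcases h x with h | h
    · exact .inl (Finset.mem_image.2 ⟨_, Finset.mem_univ _, h⟩)
    · exact .inr ⟨_, Finset.mem_image_of_mem _ (Finset.mem_univ _), h⟩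

variable [Fintype V]

/-- Conversely, `dist_center_le` with unit 1 and no surplus bounds every distance by 1, and distance
1 is adjacency. -/
theorem exists_isDominatingSet_iff_dist (hG : G.Connected) {k : ℕ} (hk : 1 ≤ k)
    (hkn : k ≤ Fintype.card V) :
    (∃ S : Finset V, S.card = k ∧ G.IsDominatingSet S) ↔
      ∃ P : Clustering V k, P.cost (fun u v => (G.dist u v : ℚ)) = Fintype.card V - k := by
  constructor
  · rintro ⟨S, hS, h⟩
    obtain ⟨P, C, hC, hP⟩ := h.exists_clustering hk hS
    refine ⟨P, ?_⟩
    have := Clustering.sum_off_eq C (1 : ℚ)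
    rw [hC, mul_one, Nat.cast_sub hkn] at this
    rw [Clustering.cost_eq_sum, ← this]
    refine Finset.sum_congr rfl fun x _ => ?_
    have hx := hP x
    split_ifs at hx ⊢ with h
    · rw [hx, dist_self, Nat.cast_zero]
    · rw [dist_eq_one_iff_adj.2 hx, Nat.cast_one]
  · rintro ⟨P, hP⟩
    refine G.exists_isDominatingSet_of_clustering P fun x => ?_
    have := P.dist_center_le (fun u v => (G.dist u v : ℚ)) (e := 0) zero_le_one (by simp)
      (fun x y hxy => by exact_mod_cast hG.pos_dist_of_ne hxy) (by rw [hP]; simp) x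
    by_cases hx : P.center (P.cluster x) = x
    · exact .inl hx
    · refine .inr (dist_eq_one_iff_adj.1 (le_antisymm ?_ (hG.pos_dist_of_ne hx)))
      rw [add_zero] at this
      exact_mod_cast this

/-- Excesses cannot be subtracted when distances may be infinite. Instead, a badly served point `x`
is charged one extra unit, and the resulting lower bound exceeds the cost. -/
theorem exists_isDominatingSet_iff_edist {k : ℕ} (hk : 1 ≤ k) :
    (∃ S : Finset V, S.card = k ∧ G.IsDominatingSet S) ↔
      ∃ P : Clustering V k, P.cost G.edist = ((Fintype.card V - k : ℕ) : ℕ∞) := by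
  constructor
  · rintro ⟨S, hS, h⟩
    obtain ⟨P, C, hC, hP⟩ := h.exists_clustering hk hS
    refine ⟨P, ?_⟩
    have := Clustering.sum_off_eq C (1 : ℕ∞)
    rw [hC, mul_one] at this
    rw [Clustering.cost_eq_sum, ← this]
    refine Finset.sum_congr rfl fun x _ => ?_
    have hx := hP x
    split_ifs at hx ⊢ with h
    · rw [hx, edist_self]
    · exact edist_eq_one_iff_adj.2 hx
  · rintro ⟨P, hP⟩
    refine G.exists_isDominatingSet_of_clustering P fun x => ?_
    by_contra! hx
    set Z := Finset.univ.filter fun x => P.center (P.cluster x) = x with hZ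
    have hZk : Z.card ≤ k := P.card_filter_le
    have hle : ∀ y, (if y ∈ Z then 0 else (1 : ℕ∞)) + (if y = x then 1 else 0) ≤
        G.edist (P.center (P.cluster y)) y := by
      intro y
      split_ifs with h1 h2 h2
      · exact absurd (Finset.mem_filter.1 h1).2 (h2 ▸ hx.1)
      · simp
      · subst h2
        have h3 : G.edist (P.center (P.cluster y)) y ≠ 0 := fun h => hx.1 (edist_eq_zero_iff.1 h)
        have h4 : G.edist (P.center (P.cluster y)) y ≠ 1 := fun h =>
          hx.2 (edist_eq_one_iff_adj.1 h)
        -- A distance, possibly infinite, that is neither 0 nor 1 is at least 2.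
        exact Order.add_one_le_of_lt (lt_of_le_of_ne (Order.one_le_iff_pos.2
          (pos_iff_ne_zero.2 h3)) h4.symm)
      · rw [add_zero]
        exact Order.one_le_iff_pos.2 (pos_iff_ne_zero.2 fun h =>
          h1 (Finset.mem_filter.2 ⟨Finset.mem_univ _, edist_eq_zero_iff.1 h⟩))
    have h := Finset.sum_le_sum fun y (_ : y ∈ Finset.univ) => hle y
    rw [← P.cost_eq_sum, hP, Finset.sum_add_distrib, Clustering.sum_off_eq,
      Finset.sum_ite_eq' Finset.univ x] at h
    simp only [Finset.mem_univ, if_true, mul_one] at h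
    have : Fintype.card V - Z.card + 1 ≤ Fintype.card V - k := by exact_mod_cast h
    omega

end SimpleGraph

/-! ### Correctness of the reduction -/

namespace SatToMedian

variable {q : ℕ} {φ : QCNF q}

/-! ### Which points are near which. -/

section dist

variable {n : ℕ}

@[simp] theorem Label.dist_lit_lit (v u : Fin n) (b c : Bool) :
    (Label.lit v b).dist (.lit u c) = 4 := by
  rw [dist_eq]; rfl

theorem Label.dist_lit_tt (v : Fin n) (b : Bool) : (Label.lit v b).dist (.tt v) = 4 := by
  have : ∃ j, meet ((Label.lit v b).row j) ((Label.tt v).row j) = true :=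
    ⟨v, by cases b <;> simp [row, meet]⟩
  rw [dist_eq, decide_eq_true this]; rfl

theorem Label.dist_lit_cl {v : Fin n} {b : Bool} {c : List (Fin n × Bool)} (h : (v, b) ∈ c) :
    (Label.lit v b).dist (.cl c) = 4 := by
  have : ∃ j, meet ((Label.lit v b).row j) ((Label.cl c).row j) = true :=
    ⟨v, by cases b <;> simp [row, meet, h]⟩
  rw [dist_eq, decide_eq_true this]; rfl

theorem Label.eq_of_dist_w' {a : Label n} (h : a.dist .w' ≤ 5) : a = .w ∨ a = .z := by
  rw [dist_eq] at h
  cases a <;> simp_all [kind, kdist]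

theorem Label.eq_of_dist_w'_le_four {a : Label n} (h : a.dist .w' ≤ 4) : a = .w := by
  rw [dist_eq] at h
  cases a <;> simp_all [kind, kdist]

/-- Even with threshold 5, only the literals of `v` are near `tt v`; another copy of `tt v` is at
distance 6. -/
theorem Label.eq_of_dist_tt {a : Label n} {v : Fin n} (h : a.dist (.tt v) ≤ 5) :
    ∃ b, a = .lit v b := by
  rw [dist_eq] at h
  cases a with
  | lit u b =>
    refine ⟨b, ?_⟩
    by_contra hne
    have : ¬ ∃ j, meet ((Label.lit u b).row j) ((Label.tt v).row j) = true := by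
      rintro ⟨j, hj⟩
      simp only [row] at hj
      split_ifs at hj with h1 h2
      · exact hne (by rw [← h1, h2])
      all_goals simp [meet] at hj
    rw [decide_eq_false this] at h
    simp [kind, kdist] at h
  | _ => simp [kind, kdist] at h

theorem Label.eq_of_dist_cl {a : Label n} {c : List (Fin n × Bool)} (h : a.dist (.cl c) ≤ 5) :
    a = .z ∨ ∃ v b, a = .lit v b ∧ (v, b) ∈ c := by
  rw [dist_eq] at h
  cases a with
  | lit u b =>
    refine .inr ⟨u, b, rfl, ?_⟩
    by_contra hne
    have : ¬ ∃ j, meet ((Label.lit u b).row j) ((Label.cl c).row j) = true := by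
      rintro ⟨j, hj⟩
      simp only [row] at hj
      split_ifs at hj with h1
      · subst h1
        cases b <;> simp_all [meet]
      · simp [meet] at hj
    rw [decide_eq_false this] at h
    simp [kind, kdist] at h
  | z => exact .inl rfl
  | _ => simp [kind, kdist] at h

end dist

/-- The label of a point. -/
def lab (x : Fin (medianInstance φ).n) : Label φ.numVars := (labels φ).get x

theorem lab_mem (x : Fin (medianInstance φ).n) : lab x ∈ labels φ := List.get_mem ..

theorem exists_lab {a : Label φ.numVars} (h : a ∈ labels φ) :
    ∃ x : Fin (medianInstance φ).n, lab x = a := List.mem_iff_get.1 h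

theorem medianInstance_d (x y : Fin (medianInstance φ).n) :
    (medianInstance φ).d x y = if x = y then 0 else ((lab x).dist (lab y) : ℚ) := rfl

theorem medianInstance_d_le {x y : Fin (medianInstance φ).n} {m : ℕ}
    (h : (lab x).dist (lab y) ≤ m) : (medianInstance φ).d x y ≤ m := by
  rw [medianInstance_d]
  split_ifs
  · exact Nat.cast_nonneg _
  · exact_mod_cast h

theorem eq_or_dist_le {x y : Fin (medianInstance φ).n} {m : ℕ}
    (h : (medianInstance φ).d x y ≤ m) : x = y ∨ (lab x).dist (lab y) ≤ m := by
  rw [medianInstance_d] at h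
  split_ifs at h with hxy
  · exact .inl hxy
  · exact .inr (by exact_mod_cast h)

theorem used_of_lab_tt {x : Fin (medianInstance φ).n} {v : Fin φ.numVars} (h : lab x = .tt v) :
    v ∈ usedVars φ := by
  have := mem_labels.1 (h ▸ lab_mem x)
  simpa using this

theorem used_of_lab_lit {x : Fin (medianInstance φ).n} {v : Fin φ.numVars} {b : Bool}
    (h : lab x = .lit v b) : v ∈ usedVars φ := by
  have := mem_labels.1 (h ▸ lab_mem x)
  simp at this
  grind

theorem exists_of_lab_cl {x : Fin (medianInstance φ).n} {c : List (Fin φ.numVars × Bool)}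
    (h : lab x = .cl c) : c.reverse ∈ φ.clauses := by
  have := mem_labels.1 (h ▸ lab_mem x)
  simp only [reduceCtorEq, Label.cl.injEq, false_or, or_self, and_false, exists_false,
    or_false] at this
  obtain ⟨c', hc', rfl⟩ := this
  simpa using hc'

/-- If all points are close to their centers, and one of the centers is labelled `w` or `w'`, then
the centers other than it correspond to the variables, and give a satisfying assignment. -/
theorem satisfiable_of_clustering
    (S : Clustering (Fin (medianInstance φ).n) (medianInstance φ).k)
    (hS : ∀ x, (medianInstance φ).d (S.center (S.cluster x)) x ≤ 5)
    (i₀ : Fin (medianInstance φ).k) (hi₀ : lab (S.center i₀) = .w ∨ lab (S.center i₀) = .w') :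
    φ.Satisfiable ∧ ∀ i, lab (S.center i) ≠ .z := by
  classical
  have hS' : ∀ x, S.center (S.cluster x) = x ∨ (lab (S.center (S.cluster x))).dist (lab x) ≤ 5 :=
    fun x => eq_or_dist_le (by exact_mod_cast hS x)
  have hP : ∀ v : usedVars φ, ∃ x : Fin (medianInstance φ).n, lab x = .tt v := fun v =>
    exists_lab (mem_labels_of_used v.2).1
  choose P hP using hP
  -- The distinguished center together with, for each used variable, the center serving one chosen
  -- copy of its `tt` point.
  let F : Option (usedVars φ) → Fin (medianInstance φ).k := fun o => o.elim i₀ fun v => S.cluster (P v)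
  have hF : ∀ v, lab (S.center (F (some v))) = .tt v ∨ ∃ b, lab (S.center (F (some v))) = .lit v b := by
    intro v
    rcases hS' (P v) with h | h
    · exact .inl ((congrArg lab h).trans (hP v))
    · rw [hP v] at h
      exact .inr (Label.eq_of_dist_tt h)
  have hinj : Function.Injective F := by
    rintro (_ | v) (_ | u) h
    · rfl
    · have h' := hF u
      rw [← h] at h'
      change lab (S.center i₀) = _ ∨ ∃ b, lab (S.center i₀) = _ at h'
      grind
    · have h' := hF v
      rw [h] at h'
      change lab (S.center i₀) = _ ∨ ∃ b, lab (S.center i₀) = _ at h'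
      grind
    · have h1 := hF v
      have h2 := hF u
      rw [h] at h1
      refine congrArg some (Subtype.ext ?_)
      grind
  have hsurj : Function.Surjective F := by
    -- There are exactly as many centers as used variables plus one, so `F` exhausts them; in
    -- particular none is labelled z or by a clause.
    refine ((Fintype.bijective_iff_injective_and_card F).2 ⟨hinj, ?_⟩).2
    rw [Fintype.card_option, Fintype.card_coe, Fintype.card_fin]
    exact congrArg (· + 1) (numUsed_eq_card φ).symm
  have hz : ∀ i, lab (S.center i) ≠ .z := by
    intro i
    obtain ⟨_ | v, rfl⟩ := hsurj i
    · change lab (S.center i₀) ≠ .z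
      grind
    · have := hF v
      grind
  -- A variable is true if its center is the positive literal. Unused variables and those whose
  -- center is a `tt` point are set to false; no clause relies on them.
  refine ⟨⟨fun v => if h : v ∈ usedVars φ then
    decide (lab (S.center (F (some ⟨v, h⟩))) = .lit v true) else false, fun c hc => ?_⟩, hz⟩
  obtain ⟨x, hx⟩ := exists_lab (mem_labels.2 (.inr (.inr (.inr (.inl ⟨c, hc, rfl⟩)))))
  have key : ∃ v b, lab (S.center (S.cluster x)) = .lit v b ∧ (v, b) ∈ c.reverse := by
    rcases hS' x with h | h
    · exfalso
      obtain ⟨_ | v, hv⟩ := hsurj (S.cluster x)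
      · change i₀ = _ at hv
        rw [hv, h, hx] at hi₀
        simp at hi₀
      · have := hF v
        rw [hv, h, hx] at this
        simp at this
    · rw [hx] at h
      exact (Label.eq_of_dist_cl h).resolve_left (hz _)
  obtain ⟨v, b, h, hvb⟩ := key
  refine ⟨(v, b), List.mem_reverse.1 hvb, ?_⟩
  have hv : v ∈ usedVars φ := used_of_lab_lit h
  -- The literal serving the clause is the unique center belonging to its variable, so the
  -- assignment agrees with its sign.
  obtain ⟨_ | u, hu⟩ := hsurj (S.cluster x)
  · change i₀ = _ at hu
    rw [hu, h] at hi₀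
    simp at hi₀
  · have hu' := hF u
    rw [hu, h] at hu'
    have huv : u = ⟨v, hv⟩ := by
      refine Subtype.ext ?_
      grind
    subst huv
    simp only [hv, dif_pos, hu, h]
    cases b <;> simp

/-- The centers are `p` and one copy of the true literal of each used variable. The literals serve
all literal and `tt` points and the satisfied clauses, so `p` is responsible only for the special
points and the remaining clauses. It is used with p = w, e = 0 and with p = z, e = 1. -/
theorem exists_cost_le_of_assignment (a : Fin φ.numVars → Bool) (p z : Fin (medianInstance φ).n)
    (e : ℕ) (hp : ∀ v b, lab p ≠ .lit v b)
    (hd : ∀ x, x ≠ p → lab x = .z ∨ lab x = .w ∨ lab x = .w' →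
      (lab p).dist (lab x) ≤ 4 + if x = z then e else 0)
    (hcl : ∀ c ∈ φ.clauses, (lab p).dist (.cl c.reverse) ≤ 4 ∨ ∃ l ∈ c, a l.1 = l.2) :
    ∃ S : Clustering (Fin (medianInstance φ).n) (medianInstance φ).k,
      S.cost (medianInstance φ).d ≤
        (Fintype.card (Fin (medianInstance φ).n) - (medianInstance φ).k : ℚ) * 4 + e := by
  classical
  have hQ : ∀ v : usedVars φ, ∃ x : Fin (medianInstance φ).n, lab x = .lit v (a v) := fun v =>
    exists_lab ((mem_labels_of_used v.2).2 _)
  choose Q hQ using hQ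
  have hinj : Function.Injective Q := fun v u h => by
    have := (hQ v).symm.trans ((congrArg lab h).trans (hQ u))
    simp only [Label.lit.injEq] at this
    exact Subtype.ext this.1
  have hpQ : p ∉ Finset.univ.image Q := by
    simp only [Finset.mem_image, Finset.mem_univ, true_and, not_exists]
    intro v hv
    exact hp v (a v) (hv ▸ hQ v)
  refine Clustering.exists_cost_le (medianInstance φ).d (Nat.cast_nonneg _)
    (medianInstance φ).d_self (insert p (Finset.univ.image Q)) ?_ z ?_ (Finset.insert_nonempty _ _)
  · rw [Finset.card_insert_of_notMem hpQ, Finset.card_image_of_injective _ hinj, Finset.card_univ,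
      Fintype.card_coe, ← numUsed_eq_card]
    rfl
  · intro x hx
    have hxp : x ≠ p := fun h => hx (h ▸ Finset.mem_insert_self _ _)
    have hC : ∀ v, Q v ∈ insert p (Finset.univ.image Q) := fun v =>
      Finset.mem_insert_of_mem (Finset.mem_image_of_mem _ (Finset.mem_univ _))
    have lift : ∀ y ∈ insert p (Finset.univ.image Q),
        (lab y).dist (lab x) ≤ 4 + (if x = z then e else 0) →
        ∃ y ∈ insert p (Finset.univ.image Q),
          (medianInstance φ).d y x ≤ 4 + if x = z then (e : ℚ) else 0 := fun y hy h =>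
      ⟨y, hy, by have := medianInstance_d_le h; split_ifs at this ⊢ <;> simpa using this⟩
    have hle : 4 ≤ 4 + if x = z then e else 0 := Nat.le_add_right _ _
    cases h : lab x with
    | z => exact lift p (Finset.mem_insert_self _ _) (hd x hxp (.inl h))
    | w => exact lift p (Finset.mem_insert_self _ _) (hd x hxp (.inr (.inl h)))
    | w' => exact lift p (Finset.mem_insert_self _ _) (hd x hxp (.inr (.inr h)))
    | lit v b =>
      refine lift (Q ⟨v, used_of_lab_lit h⟩) (hC _) ?_
      rwa [hQ, h, Label.dist_lit_lit]
    | tt v =>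
      refine lift (Q ⟨v, used_of_lab_tt h⟩) (hC _) ?_
      rwa [hQ, h, Label.dist_lit_tt]
    | cl c =>
      have hc := exists_of_lab_cl h
      rcases hcl _ hc with h' | ⟨⟨v, b⟩, hl, hb⟩
      · rw [List.reverse_reverse] at h'
        exact lift p (Finset.mem_insert_self _ _) (by rw [h]; exact h'.trans hle)
      · refine lift (Q ⟨v, mem_usedVars.2 ⟨_, hc, _, hl⟩⟩) (hC _) ?_
        have hb : a v = b := hb
        rwa [hQ, h, Label.dist_lit_cl (List.mem_reverse.1 (hb ▸ hl))]

theorem IsOptimal.dist_le {I : KMedianInstance} {S S' : Clustering (Fin I.n) I.k}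
    (hS : I.IsOptimal S) (h4 : ∀ x y, x ≠ y → 4 ≤ I.d x y) {e : ℕ}
    (h : S'.cost I.d ≤ (Fintype.card (Fin I.n) - I.k : ℚ) * 4 + e) (x : Fin I.n) :
    I.d (S.center (S.cluster x)) x ≤ (4 + e : ℕ) := by
  have := S.dist_center_le I.d (e := e) (by norm_num) I.d_self h4 ((hS S').trans h) x
  simpa using this

theorem four_le_medianInstance_d {x y : Fin (medianInstance φ).n} (h : x ≠ y) :
    4 ≤ (medianInstance φ).d x y := by
  rw [medianInstance_d, if_neg h]
  exact_mod_cast Label.four_le_dist _ _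

/-- The formula is unsatisfiable if and only if the first point is a center. -/
theorem optimal_iff (S : Clustering (Fin (medianInstance φ).n) (medianInstance φ).k)
    (hS : (medianInstance φ).IsOptimal S) :
    (∃ i, (S.center i : ℕ) = 0) ↔ ¬ φ.Satisfiable := by
  classical
  obtain ⟨x', hx'⟩ := exists_lab (φ := φ) (a := .w') (mem_labels.2 (by simp))
  obtain ⟨x₀, hx₀⟩ := exists_lab (φ := φ) (a := .z) (mem_labels.2 (by simp))
  obtain ⟨x₁, hx₁⟩ := exists_lab (φ := φ) (a := .w) (mem_labels.2 (by simp))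
  have hw : ∀ m : ℕ, (medianInstance φ).d (S.center (S.cluster x')) x' ≤ m →
      lab (S.center (S.cluster x')) = .w' ∨ (lab (S.center (S.cluster x'))).dist .w' ≤ m :=
    fun m h => (eq_or_dist_le h).imp (fun h => (congrArg lab h).trans hx') (fun h => hx' ▸ h)
  by_cases hsat : φ.Satisfiable
  · simp only [hsat, not_true_eq_false, iff_false]
    obtain ⟨a, ha⟩ := hsat
    -- With w as the extra center there is no surplus, so every point of an optimal clustering is
    -- within 4 of its center, and w' must be served by w or by itself.
    obtain ⟨S', hS'⟩ := exists_cost_le_of_assignment a x₁ x₁ 0 (by simp [hx₁])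
      (fun x _ hx => by
        rw [hx₁, Label.dist_eq]
        rcases hx with h | h | h <;> rw [h] <;> simp [Label.kind, kdist])
      (fun c hc => .inr (ha c hc))
    have hd := IsOptimal.dist_le hS (fun _ _ => four_le_medianInstance_d) hS'
    have hz := (satisfiable_of_clustering S (fun x => (hd x).trans (by norm_num)) (S.cluster x')
      ((hw _ (hd x')).symm.imp_left Label.eq_of_dist_w'_le_four)).2
    rintro ⟨i, hi⟩
    have : S.center i = ⟨0, by have := (S.center i).isLt; omega⟩ := Fin.ext hi
    exact hz i (by rw [this]; rfl)
  · simp only [hsat, not_false_eq_true, iff_true]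
    -- The point z serves all clauses, so any assignment will do; the surplus 1 is the distance 5
    -- from z to w'.
    obtain ⟨S', hS'⟩ := exists_cost_le_of_assignment (fun _ => true) x₀ x' 1 (by simp [hx₀])
      (fun x hx h => by
        rw [hx₀, Label.dist_eq]
        rcases h with h | h | h
        · exact absurd (Fin.ext ((labels_eq_z φ h).trans (labels_eq_z φ hx₀).symm)) hx
        · rw [h]; simp [Label.kind, kdist]
        · have hxx' : x = x' := Fin.ext ((labels_eq_w' φ h).trans (labels_eq_w' φ hx').symm)
          rw [h, if_pos hxx']
          simp [Label.kind, kdist])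
      (fun c _ => .inl (by rw [hx₀, Label.dist_eq]; simp [Label.kind, kdist]))
    have hd := IsOptimal.dist_le hS (fun _ _ => four_le_medianInstance_d) hS'
    have h5 : ∀ x, (medianInstance φ).d (S.center (S.cluster x)) x ≤ 5 := fun x =>
      (hd x).trans (by norm_num)
    -- The center serving w' is z: the alternatives w and w' would yield a satisfying assignment.
    refine ⟨S.cluster x', labels_eq_z φ (?_ : lab _ = _)⟩
    by_contra hne
    refine hsat (satisfiable_of_clustering S h5 (S.cluster x') ?_).1
    rcases hw 5 (h5 x') with h | h
    · exact .inr h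
    · exact .inl ((Label.eq_of_dist_w' h).resolve_right hne)

end SatToMedian

/-! ### Running time of the reduction -/

theorem List.length_flatMap_le {α β : Type*} {l : List α} {f : α → List β} {b : ℕ}
    (h : ∀ a ∈ l, (f a).length ≤ b) : (l.flatMap f).length ≤ l.length * b := by
  induction l with
  | nil => simp
  | cons a l ih =>
    have h1 := h a (by simp)
    have h2 := ih fun x hx => h x (List.mem_cons_of_mem _ hx)
    simp only [List.flatMap_cons, List.length_append, List.length_cons, add_mul]
    omega

theorem Polynomial.eval_mono_nat (p : Polynomial ℕ) {a b : ℕ} (h : a ≤ b) :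
    p.eval a ≤ p.eval b := by
  rw [Polynomial.eval_eq_sum_range, Polynomial.eval_eq_sum_range]
  gcongr

/-- A function that is `o(N)` is bounded at arguments `N ≤ a * m + b` by a function of `m` that is
`o(m)`. -/
theorem exists_isLittleO_of_le {f : ℕ → ℝ} (hf : f =o[atTop] fun N : ℕ => (N : ℝ)) (a b : ℕ) :
    ∃ g : ℕ → ℝ, g =o[atTop] (fun m : ℕ => (m : ℝ)) ∧ ∀ m N, N ≤ a * m + b → f N ≤ g m := by
  have hne : ∀ m, (Finset.range (a * m + b + 1)).Nonempty := fun m => ⟨0, by simp⟩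
  -- As `f` need not be monotone or nonnegative, it is replaced by the maximum of its absolute
  -- values over the whole range of admissible N.
  refine ⟨fun m => (Finset.range (a * m + b + 1)).sup' (hne m) fun N => |f N|, ?_, ?_⟩
  · rw [isLittleO_iff]
    intro c hc
    -- Chosen so that c' * a ≤ c / 2; the other half of c absorbs the constants K + c' * b once m is
    -- large.
    have hc' : 0 < c / (2 * (a + 1)) := by positivity
    obtain ⟨N₀, hN₀⟩ := eventually_atTop.1 (isLittleO_iff.1 hf hc')
    set c' := c / (2 * (a + 1)) with hc'_def
    set K := ∑ N ∈ Finset.range N₀, |f N| with hK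
    have hK0 : 0 ≤ K := Finset.sum_nonneg fun _ _ => abs_nonneg _
    have hbound : ∀ N : ℕ, |f N| ≤ K + c' * N := by
      intro N
      rcases lt_or_ge N N₀ with h | h
      · have h1 : |f N| ≤ K := Finset.single_le_sum (f := fun N => |f N|)
          (fun _ _ => abs_nonneg _) (Finset.mem_range.2 h)
        have h2 : 0 ≤ c' * N := by positivity
        linarith
      · have h1 := hN₀ N h
        simp only [Real.norm_eq_abs, Nat.abs_cast] at h1
        linarith
    obtain ⟨m₀, hm₀⟩ := exists_nat_ge ((K + c' * b) / (c / 2))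
    filter_upwards [eventually_ge_atTop m₀] with m hm
    have hm' : K + c' * b ≤ m * (c / 2) := by
      rw [← div_le_iff₀ (by positivity)]
      exact hm₀.trans (by exact_mod_cast hm)
    have hca : c' * a ≤ c / 2 := by
      rw [hc'_def, div_mul_eq_mul_div, div_le_div_iff₀ (by positivity) (by norm_num)]
      nlinarith [(Nat.cast_nonneg a : (0 : ℝ) ≤ a)]
    have hsup : (Finset.range (a * m + b + 1)).sup' (hne m) (fun N => |f N|) ≤ c * m := by
      refine Finset.sup'_le _ _ fun N hN => (hbound N).trans ?_
      have hN' : (N : ℝ) ≤ a * m + b := by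
        exact_mod_cast Nat.lt_succ_iff.1 (Finset.mem_range.1 hN)
      have h1 : c' * N ≤ c' * (a * m + b) := by gcongr
      have h2 : c' * a * m ≤ c / 2 * m := by gcongr
      nlinarith
    have hsup0 : 0 ≤ (Finset.range (a * m + b + 1)).sup' (hne m) (fun N => |f N|) :=
      (abs_nonneg (f 0)).trans
        (Finset.le_sup' (fun N => |f N|) (Finset.mem_range.2 (Nat.succ_pos _)))
    simpa only [Real.norm_eq_abs, abs_of_nonneg hsup0, Nat.abs_cast] using hsup
  · intro m N hN
    exact (le_abs_self _).trans
      (Finset.le_sup' (fun N => |f N|) (Finset.mem_range.2 (Nat.lt_succ_of_le hN)))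

namespace SatToMedian

variable {q : ℕ} (φ : QCNF q)

/-! ### Size of the instance. -/

theorem length_tokens :
    (tokens φ).length = (φ.clauses.map fun c => c.length + 1).sum := by
  simp [tokens, List.length_flatMap]

theorem numVars_add_length_tokens_le : φ.numVars + (tokens φ).length ≤ φ.encode.length := by
  have : ∀ ts : List (Token φ.numVars), ts.length ≤ (ts.flatMap Token.encode).length := by
    intro ts
    induction ts with
    | nil => simp
    | cons t ts ih =>
      have : 1 ≤ t.encode.length := by cases t <;> simp [Token.encode]
      simp only [List.flatMap_cons, List.length_append, List.length_cons]
      omega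
  have h := this (tokens φ)
  rw [encode_eq_tokens, List.length_append]
  simp only [encUnary, List.length_append, List.length_replicate, List.length_singleton]
  omega

theorem length_labels_le : (labels φ).length ≤ 3 * (tokens φ).length + 3 := by
  rw [length_labels, length_tokens, add_comm]
  refine Nat.add_le_add_right ?_ 3
  induction φ.clauses with
  | nil => simp
  | cons c cs ih => simp only [List.map_cons, List.sum_cons]; omega

/-- The linear bound on which the exponent depends: a clause has at most q literals, each causing
three points, and one point of its own. -/
theorem length_labels_le_numClauses :
    (labels φ).length ≤ (3 * q + 1) * φ.numClauses + 3 := by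
  rw [length_labels, add_comm, QCNF.numClauses, mul_comm]
  refine Nat.add_le_add_right ((List.sum_le_card_nsmul _ (3 * q + 1) ?_).trans (by simp)) 3
  intro x hx
  obtain ⟨c, hc, rfl⟩ := List.mem_map.1 hx
  have := φ.length_le c hc
  omega

theorem length_instWord_le {B : ℕ} (hB : (labels φ).length ≤ B) :
    (instWord φ).length ≤ 6 * B ^ 2 + 2 * B + 2 := by
  have hd : ∀ d, (distWord d).length ≤ 6 := fun d => by
    rw [distWord]
    split_ifs <;> simp
  have h1 : (matrixWord [] ((labels φ).map Label.pt)).length ≤ B * (B * 6) := by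
    rw [matrixWord_eq _ [] _ rfl]
    refine (List.length_flatMap_le fun x _ => List.length_flatMap_le fun y _ => hd _).trans ?_
    simp only [List.length_nil, List.drop_zero, List.length_finRange, List.nil_append, List.length_map]
    gcongr
  have h2 := numUsed_lt_length_labels φ
  simp only [instWord, encUnary, List.length_append, List.length_replicate, List.length_singleton]
  nlinarith

/-- The overhead of the decision procedure, for instances of size at most `B`. -/
def overhead {R : Type*} [CommSemiring R] (B : R) : R :=
  (16 * B + 15) * B + B * (B * (6 * B + 9) + 2 * B + 4) + 2 * (B * (B + 1)) + 2 * B + 19 * B + 30 +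
    2 * (6 * B ^ 2 + 2 * B + 2) + 10 * B ^ 2 + B * (2 * B + 3) + 6

/-! ### Transfer of the running time from k-Median to satisfiability. -/

variable (M : Turing.TM2ComputableAux (Option Bool) (Option Bool))

theorem outputs_decider {w : List (Option Bool)} {t B : ℕ} (hB : 3 * φ.encode.length + 3 ≤ B)
    (hw : kMedian.Correct (medianInstance φ) w)
    (h : Nonempty (Turing.TM2OutputsInTime M.tm
      ((medianInstance φ).encode.map M.inputAlphabet.symm)
      (some (w.map M.outputAlphabet.symm)) t)) :
    ∃ w', (qSAT q).Correct φ w' ∧ Nonempty (Turing.TM2OutputsInTime (deciderAux M).tm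
      (φ.encode.map (deciderAux M).inputAlphabet.symm)
      (some (w'.map (deciderAux M).outputAlphabet.symm)) (t + overhead B)) := by
  obtain ⟨S, hS, rfl⟩ := hw
  obtain ⟨h⟩ := h
  rw [← instWord_eq_encode] at h
  have hT := numVars_add_length_tokens_le φ
  have hN := length_labels_le φ
  have hNB : (labels φ).length ≤ B := by omega
  have hk := numUsed_lt_length_labels φ
  have hn' : (medianInstance φ).n = (labels φ).length := rfl
  have hk' : (medianInstance φ).k = numUsed φ + 1 := rfl
  set l := (List.finRange (medianInstance φ).k).map fun i => (S.center i : ℕ) with hl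
  set rest := (List.finRange (medianInstance φ).n).flatMap fun x => encUnary (S.cluster x) with hrest
  have hw : S.encode = l.flatMap encUnary ++ rest := by
    rw [hl, List.flatMap_map]
    rfl
  have hlB : ∀ a ∈ l, a ≤ B := by
    intro a ha
    obtain ⟨i, _, rfl⟩ := List.mem_map.1 ha
    exact (S.center i).isLt.le.trans hNB
  have hll : l.length = numUsed φ + 1 := by simp [hl, hk']
  have hrB : rest.length ≤ B ^ 2 := by
    refine (List.length_flatMap_le (b := B) fun x _ => ?_).trans ?_
    · have : (S.cluster x : ℕ) < numUsed φ + 1 := (S.cluster x).isLt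
      simp only [encUnary, List.length_append, List.length_replicate, List.length_singleton]
      omega
    · rw [List.length_finRange, sq, hn']
      gcongr
  have hlB' : (l.flatMap encUnary).length ≤ B ^ 2 := by
    refine (List.length_flatMap_le (b := B) fun x hx => ?_).trans ?_
    · obtain ⟨i, _, rfl⟩ := List.mem_map.1 hx
      have : (S.center i : ℕ) < (labels φ).length := (S.center i).isLt
      simp only [encUnary, List.length_append, List.length_replicate, List.length_singleton]
      omega
    · rw [hll, sq]
      gcongr
      omega
  rw [hw] at h
  -- All sizes are replaced by B. Each of the two halves of the answer has length at most B ^ 2,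
  -- which accounts for the term 10 * B ^ 2 of the overhead.
  have hrun := (runs_decider M φ hll hlB h).mono (t' := t + overhead B) (by
    have h1 := length_instWord_le φ hNB
    have h2 : reduceTime φ.numVars (labels φ).length (tokens φ).length ≤ reduceTime B B B := by
      unfold reduceTime
      gcongr <;> omega
    have h3 : l.length * (2 * B + 3) ≤ B * (2 * B + 3) := by
      gcongr
      omega
    have h4 : (l.flatMap encUnary ++ rest).length ≤ 2 * B ^ 2 := by
      rw [List.length_append]; omega
    unfold overhead
    unfold reduceTime at h2 ⊢
    omega)
  refine ⟨_, ⟨_, ?_, rfl⟩, outputs_of_runs M hrun⟩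
  have := optimal_iff S hS
  have hany : l.any (· == 0) = true ↔ ∃ i, (S.center i : ℕ) = 0 := by
    simp [hl]
  rw [← not_iff_not, ← this, ← hany]
  simp

theorem qSAT_solvable (h : kMedian.SolvableInSubexpTime KMedianInstance.n) :
    (qSAT q).SolvableInSubexpTime QCNF.numClauses := by
  obtain ⟨f, p, hf, M, hM⟩ := h
  obtain ⟨g, hg, hfg⟩ := exists_isLittleO_of_le hf (3 * q + 1) 3
  -- A nonnegative exponent makes the exponential factor at least 1, so that the additive overhead
  -- can be put under it.
  obtain ⟨g', hg', hgg'⟩ : ∃ g' : ℕ → ℝ, g' =o[atTop] (fun m : ℕ => (m : ℝ)) ∧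
      ∀ m, 0 ≤ g' m ∧ g m ≤ g' m :=
    ⟨fun m => |g m|, hg.abs_left, fun m => ⟨abs_nonneg _, le_abs_self _⟩⟩
  set B : Polynomial ℕ := 3 * Polynomial.X + 3 with hB
  -- The argument of `p` is the bound of `length_instWord_le` on the length of the instance, with at
  -- most B = 3 * X + 3 points for a formula of length X.
  refine ⟨g', overhead B + p.comp (6 * B ^ 2 + 2 * B + 2), hg', deciderAux M, fun (φ : QCNF q) => ?_⟩
  obtain ⟨w, t, hw, ht, hout⟩ := hM (medianInstance φ)
  obtain ⟨w', hw', hout'⟩ := outputs_decider φ M (B := 3 * φ.encode.length + 3) le_rfl hw hout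
  refine ⟨w', _, hw', ?_, hout'⟩
  have hT := numVars_add_length_tokens_le φ
  have hN := length_labels_le φ
  have hlen : (medianInstance φ).encode.length ≤
      6 * (3 * φ.encode.length + 3) ^ 2 + 2 * (3 * φ.encode.length + 3) + 2 := by
    rw [← instWord_eq_encode]
    exact length_instWord_le φ (by omega)
  have hp := p.eval_mono_nat hlen
  have heval : (overhead B + p.comp (6 * B ^ 2 + 2 * B + 2)).eval φ.encode.length =
      overhead (3 * φ.encode.length + 3) + p.eval
        (6 * (3 * φ.encode.length + 3) ^ 2 + 2 * (3 * φ.encode.length + 3) + 2) := by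
    simp [overhead, hB, Polynomial.eval_comp]
  have hpow : (2 : ℝ) ^ f (medianInstance φ).n ≤ 2 ^ g' φ.numClauses :=
    Real.rpow_le_rpow_of_exponent_le one_le_two
      ((hfg _ _ (length_labels_le_numClauses φ)).trans (hgg' _).2)
  have hone : (1 : ℝ) ≤ 2 ^ g' φ.numClauses := Real.one_le_rpow one_le_two (hgg' _).1
  have ht' : (t : ℝ) ≤ 2 ^ f (medianInstance φ).n *
    ((p.eval (medianInstance φ).encode.length : ℕ) : ℝ) := ht
  change ((t + overhead (3 * φ.encode.length + 3) : ℕ) : ℝ) ≤ 2 ^ g' φ.numClauses *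
    (((overhead B + p.comp (6 * B ^ 2 + 2 * B + 2)).eval φ.encode.length : ℕ) : ℝ)
  rw [heval, Nat.cast_add, Nat.cast_add, mul_add, add_comm]
  refine add_le_add (le_mul_of_one_le_left (Nat.cast_nonneg _) hone) (ht'.trans ?_)
  gcongr

end SatToMedian

theorem mainTheorem2 :
    (ExponentialTimeHypothesis →
      ¬ kMedian.SolvableInSubexpTime KMedianInstance.n) ∧
    (∀ (n : ℕ) (G : SimpleGraph (Fin n)) (hG : G.Connected) (k : ℕ) (hk : 1 ≤ k) (hkn : k ≤ n),
      (∃ S : Finset (Fin n), S.card = k ∧ G.IsDominatingSet S) ↔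
        ∃ P : Clustering (Fin n) k,
          P.cost (shortestPathInstance G hG k hk hkn).d = (n : ℚ) - (k : ℚ)) ∧
    (∀ (n : ℕ) (G : SimpleGraph (Fin n)) (k : ℕ), 1 ≤ k → k ≤ n →
      ((∃ S : Finset (Fin n), S.card = k ∧ G.IsDominatingSet S) ↔
        ∃ P : Clustering (Fin n) k, P.cost G.edist = ((n - k : ℕ) : ℕ∞))) := by
  refine ⟨fun hETH h => (hETH 3 le_rfl).2 (SatToMedian.qSAT_solvable h),
    fun n G hG k hk hkn => ?_, fun n G k hk _ => ?_⟩
  · have := G.exists_isDominatingSet_iff_dist hG hk (by rwa [Fintype.card_fin])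
    rw [Fintype.card_fin] at this
    exact this
  · have := G.exists_isDominatingSet_iff_edist hk
    rw [Fintype.card_fin] at this
    exact this
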